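/- Let $n\ge 3$, $\mathbb R^n_+=\{x=(x',x_n): x'\in\mathbb R^{n-1},\ x_n>0\}$, and identify $\partial\mathbb R^n_+$ with $\mathbb R^{n-1}$. Let $\rho>1$ with $\frac{\rho}{\rho-1}<n-1$, and put $p=n(\rho-1)$, $q=(n-1)(\rho-1)$. For $1<r<\infty$ the space $L^{(r,\infty)}$ (weak $L^r$) carries the norm $\|f\|_{L^{(r,\infty)}}=\sup_{t>0}t^{1/r}f^{**}(t)$, where $f^{**}(t)=\frac1t\int_0^t f^*(s)\,ds$ and $f^*$ is the decreasing rearrangement of $f$. Let $\mathcal X_{p,q}$ be the Banach space of measurable functions $f$ on $\overline{\mathbb R^n_+}$, two of which are identified when they agree a.e. in $\mathbb R^n_+$ and a.e. on $\partial\mathbb R^n_+$, with norm $\|f\|_{\mathcal X_{p,q}}=\|f\|_{L^{(p,\infty)}(\mathbb R^n_+)}+\|f|_{\partial\mathbb R^n_+}\|_{L^{(q,\infty)}(\partial\mathbb R^n_+)}$, and let $BC((0,\infty);\mathcal X_{p,q})$ be the space of bounded continuous functions from $(0,\infty)$ to $\mathcal X_{p,q}$. Let $$G(x,y,t)=(4\pi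 t)^{-n/2}\Big[e^{-|x-y|^2/4t}+e^{-|x-y^*|^2/4t}\Big],\qquad y^*=(y',-y_n).$$ Given $h:\mathbb R\to\mathbb R$, $V\in L^{(n-1,\infty)}(\partial\mathbb R^n_+)$ and $u_0\in L^{(p,\infty)}(\mathbb R^n_+)$, consider the integral equation $$u(x,t)=\int_{\mathbb R^n_+}G(x,y,t)u_0(y)\,dy+\int_0^t\!\int_{\partial\mathbb R^n_+}G(x,y',t-s)\,[h(u)+Vu](y',s)\,dy'\,ds \qquad(\ast)$$ of the problem $\partial_tu=\Delta u$ in $\mathbb R^n_+$, $-\partial_{x_n}u=h(u)+Vu$ on $\partial\mathbb R^n_+$, $u(\cdot,0)=u_0$. A solution is a $u\in BC((0,\infty);\mathcal X_{p,q})$ such that for every $t>0$ the two sides of $(\ast)$ agree as elements of $\mathcal X_{p,q}$. There is a constant $\delta_1>0$, depending only on $n$ and $\rho$, such that for all $\eta\in\mathbb R$ and $\gamma_0<1$ there is an $\varepsilon>0$ with the following property. Let $h(0)=0$ and $|h(a)-h(b)|\le\eta|a-b|(|a|^{\rho-1}+|b|^{\rho-1})$ for all $a,b\in\mathbb R$,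 let $V\in L^{(n-1,\infty)}(\partial\mathbb R^n_+)$ with $\gamma:=\delta_1\|V\|_{L^{(n-1,\infty)}(\partial\mathbb R^n_+)}\le\gamma_0$, let $u_0\in L^{(p,\infty)}(\mathbb R^n_+)$, and let $u\in BC((0,\infty);\mathcal X_{p,q})$ be a solution of $(\ast)$ with $\sup_{t>0}\|u(\cdot,t)\|_{\mathcal X_{p,q}}\le\frac{2\varepsilon}{1-\gamma}$. (A) Suppose $h(a)\ge0$ for all $a\ge0$ (resp. $h(a)\le0$ for all $a\le0$), $V\ge0$ a.e. on $\partial\mathbb R^n_+$, $u_0\ge0$ (resp. $u_0\le0$) a.e. in $\mathbb R^n_+$, and $u_0>0$ (resp. $u_0<0$) on a set $\mathcal U\subset\mathbb R^n_+$ of positive measure. Then $u$ is positive (resp. negative) in $\mathbb R^n_+\times(0,\infty)$: for every $t>0$, $u(x,t)>0$ (resp. $<0$) for a.e. $x\in\mathbb R^n_+$, and the representative of $u$ given by the right-hand side of $(\ast)$ is $>0$ (resp. $<0$) at every point of $\mathbb R^n_+\times(0,\infty)$. (B) Suppose $h(a)=-h(-a)$ for all $a\in\mathbb R$. Let $\mathcal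 A$ be a set of rotations about the $x_n$-axis, i.e. of maps $T(x',x_n)=(Rx',x_n)$ with $R$ an orthogonal map of $\mathbb R^{n-1}$, and let $V$ be symmetric under $\mathcal A|_{\partial\mathbb R^n_+}$. If $u_0$ is symmetric (resp. antisymmetric) under $\mathcal A$, then for all $t>0$ so is $u(\cdot,t)$, both in $\mathbb R^n_+$ and on $\partial\mathbb R^n_+$. Here $f$ is symmetric (resp. antisymmetric) under $\mathcal A$ if, for every $T\in\mathcal A$, $f(x)=f(T(x))$ (resp. $f(x)=-f(T(x))$) for a.e. $x$. -/

import Mathlib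

open MeasureTheory Set Filter Topology
open scoped ENNReal

noncomputable section

namespace HalfSpaceHeat

/-- The distribution function `λ_f(s) = μ {x : |f x| > s}`. -/
def distribution {α : Type*} [MeasurableSpace α] (μ : Measure α) (f : α → ℝ) (s : ℝ≥0∞) : ℝ≥0∞ :=
  μ {x | s < ‖f x‖ₑ}

/-- The decreasing rearrangement `f^*(t) = inf {s > 0 : λ_f(s) ≤ t}`. -/
def rearrangement {α : Type*} [MeasurableSpace α] (μ : Measure α) (f : α → ℝ) (t : ℝ) : ℝ≥0∞ :=
  sInf {s : ℝ≥0∞ | 0 < s ∧ distribution μ f s ≤ ENNReal.ofReal t}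

/-- The averaged rearrangement `f^{**}(t) = (1/t) ∫_0^t f^*(s) ds`. -/
def avgRearrangement {α : Type*} [MeasurableSpace α] (μ : Measure α) (f : α → ℝ) (t : ℝ) : ℝ≥0∞ :=
  (ENNReal.ofReal t)⁻¹ * ∫⁻ s in Ioo 0 t, rearrangement μ f s

/-- The norm `‖f‖_{L^{(p,∞)}(μ)} = sup_{t > 0} t^{1/p} f^{**}(t)` of weak `L^p`, for `1 < p < ∞`. -/
def weakNorm {α : Type*} [MeasurableSpace α] (p : ℝ) (μ : Measure α) (f : α → ℝ) : ℝ≥0∞ :=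
  ⨆ t : ℝ, ⨆ _ : 0 < t, ENNReal.ofReal t ^ (1 / p) * avgRearrangement μ f t

/-- `f` belongs to `L^{(p,∞)}(μ)`. -/
def MemWeak {α : Type*} [MeasurableSpace α] (p : ℝ) (μ : Measure α) (f : α → ℝ) : Prop :=
  AEStronglyMeasurable f μ ∧ weakNorm p μ f < ∞

/-- The boundary `ℝ^{n-1} = ∂ℝ^n_+`. -/
abbrev Bdry (n : ℕ) : Type := EuclideanSpace ℝ (Fin (n - 1))

/-- `ℝ^n`, whose points are written `x = (x', x_n)`; its volume is `dx = dx' dx_n`. (The norm that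
Lean puts on this product type is never used.) -/
abbrev Space (n : ℕ) : Type := Bdry n × ℝ

/-- The open half-space `ℝ^n_+ = {x_n > 0}`. -/
def halfSpace (n : ℕ) : Set (Space n) := {x | 0 < x.2}

/-- Lebesgue measure on `ℝ^n_+`. -/
def volHalf (n : ℕ) : Measure (Space n) := volume.restrict (halfSpace n)

/-- The restriction `y' ↦ f(y', 0)` of `f` to the boundary. -/
def trace {n : ℕ} (f : Space n → ℝ) : Bdry n → ℝ := fun y => f (y, 0)

/-- The norm of `𝒳_{p,q}`. Elements of `𝒳_{p,q}` are represented by functions, of which only the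
a.e. class on `ℝ^n_+` and the a.e. class of the restriction to the boundary matter. -/
def normX {n : ℕ} (p q : ℝ) (f : Space n → ℝ) : ℝ≥0∞ :=
  weakNorm p (volHalf n) f + weakNorm q volume (trace f)

/-- `f` represents an element of `𝒳_{p,q}`. -/
def MemX {n : ℕ} (p q : ℝ) (f : Space n → ℝ) : Prop :=
  MemWeak p (volHalf n) f ∧ MemWeak q volume (trace f)

/-- `u` represents an element of `BC((0,∞); 𝒳_{p,q})`, the bounded continuous functions from
`(0,∞)` to `𝒳_{p,q}`. The boundary values are represented by a function that is measurable in time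
and space jointly; a continuous curve in `𝒳_{p,q}` always has such a representative. -/
structure MemBC {n : ℕ} (p q : ℝ) (u : ℝ → Space n → ℝ) : Prop where
  memX : ∀ t, 0 < t → MemX p q (u t)
  measurable_trace : AEStronglyMeasurable (fun z : ℝ × Bdry n => trace (u z.1) z.2)
    ((volume.restrict (Ioi 0)).prod volume)
  bounded : ∃ M : ℝ≥0∞, M < ∞ ∧ ∀ t, 0 < t → normX p q (u t) ≤ M
  continuous : ∀ t, 0 < t → Tendsto (fun s => normX p q (u s - u t)) (𝓝 t) (𝓝 0)

/-- The heat kernel of the half-space with Neumann boundary condition,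
`G(x,y,t) = (4πt)^{-n/2} (exp(-|x-y|²/(4t)) + exp(-|x-y^*|²/(4t)))` with `y^* = (y', -y_n)`. -/
def heatKernel {n : ℕ} (x y : Space n) (t : ℝ) : ℝ :=
  (4 * Real.pi * t) ^ (-(n : ℝ) / 2) *
    (Real.exp (-(‖x.1 - y.1‖ ^ 2 + (x.2 - y.2) ^ 2) / (4 * t)) +
      Real.exp (-(‖x.1 - y.1‖ ^ 2 + (x.2 + y.2) ^ 2) / (4 * t)))

/-- The right-hand side of the integral equation,
`∫_{ℝ^n_+} G(x,y,t) u₀(y) dy + ∫_0^t ∫_{∂ℝ^n_+} G(x,y',t-s) [h(u) + V u](y',s) dy' ds`. -/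
def mildMap {n : ℕ} (h : ℝ → ℝ) (V : Bdry n → ℝ) (u₀ : Space n → ℝ) (u : ℝ → Space n → ℝ)
    (t : ℝ) (x : Space n) : ℝ :=
  (∫ y, heatKernel x y t * u₀ y ∂(volHalf n)) +
    ∫ s in (0 : ℝ)..t, ∫ y' : Bdry n, heatKernel x (y', 0) (t - s) *
      (h (trace (u s) y') + V y' * trace (u s) y')

/-- `u ∈ BC((0,∞); 𝒳_{p,q})` solves the integral equation: for every `t > 0` the two sides are the
same element of `𝒳_{p,q}`. -/
structure IsMildSolution {n : ℕ} (p q : ℝ) (h : ℝ → ℝ) (V : Bdry n → ℝ) (u₀ : Space n → ℝ)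
    (u : ℝ → Space n → ℝ) : Prop where
  memBC : MemBC p q u
  eq_interior : ∀ t, 0 < t → ∀ᵐ x ∂(volHalf n), u t x = mildMap h V u₀ u t x
  eq_boundary : ∀ t, 0 < t → ∀ᵐ y' : Bdry n, u t (y', 0) = mildMap h V u₀ u t (y', 0)

/-- The rotation `(x', x_n) ↦ (R x', x_n)` about the `x_n`-axis, for an orthogonal map `R` of
`ℝ^{n-1}`. -/
def axisRotation {n : ℕ} (R : Bdry n ≃ₗᵢ[ℝ] Bdry n) (x : Space n) : Space n := (R x.1, x.2)

/-- `f`, as a function on the open half-space, is symmetric under the rotations in `𝒜`. -/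
def IsSymm {n : ℕ} (𝒜 : Set (Bdry n ≃ₗᵢ[ℝ] Bdry n)) (f : Space n → ℝ) : Prop :=
  ∀ R ∈ 𝒜, ∀ᵐ x ∂(volHalf n), f x = f (axisRotation R x)

/-- `f`, as a function on the open half-space, is antisymmetric under the rotations in `𝒜`. -/
def IsAntisymm {n : ℕ} (𝒜 : Set (Bdry n ≃ₗᵢ[ℝ] Bdry n)) (f : Space n → ℝ) : Prop :=
  ∀ R ∈ 𝒜, ∀ᵐ x ∂(volHalf n), f x = -f (axisRotation R x)

/-- A function on the boundary is symmetric under the restrictions of the rotations in `𝒜`. -/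
def IsSymmBdry {n : ℕ} (𝒜 : Set (Bdry n ≃ₗᵢ[ℝ] Bdry n)) (g : Bdry n → ℝ) : Prop :=
  ∀ R ∈ 𝒜, ∀ᵐ y' : Bdry n, g y' = g (R y')

/-- A function on the boundary is antisymmetric under the restrictions of the rotations in `𝒜`. -/
def IsAntisymmBdry {n : ℕ} (𝒜 : Set (Bdry n ≃ₗᵢ[ℝ] Bdry n)) (g : Bdry n → ℝ) : Prop :=
  ∀ R ∈ 𝒜, ∀ᵐ y' : Bdry n, g y' = -g (R y')

end HalfSpaceHeat

end

namespace HalfSpaceHeat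

/-! Everything is decided on the boundary: the right-hand side of the integral equation sees `u`
only through its trace, so the trace `w` solves a closed equation, and whatever is known about `w`
passes to the half-space through that right-hand side.

Put m = n - 1 and r = q/ρ, so that 1/r = 1/m + 1/q. If the trace is small in weak L^q, then
|w|^(ρ-1) is small in weak L^m, the space that contains V. The reaction w ↦ h(w) + Vw is therefore
Lipschitz with a coefficient M that is small in weak L^m (`weakBound_lipCoeff`), and multiplication
by M maps weak L^q to weak L^r by Hölder's inequality. The boundary heat potential maps back from
weak L^r to weak L^q, uniformly in time (`IsHeatLike.exists_weakBound_potential`). This critical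
estimate is proved by splitting at a time lag and at a level: the early times and the low values
give a uniformly bounded function, and the recent high values are integrable, so that Chebyshev's
inequality applies. The condition ρ/(ρ-1) < n-1 says that r > 1.

Hence a curve D with |D| ≤ potential of M|D| satisfies a bound that shrinks by a factor below 1 at
each iteration, and D = 0 (`HeatPotentialBound.ae_eq_zero`). This is used twice. With D the
difference of two small solutions it gives uniqueness of the trace; a rotated solution, with its
sign changed in the antisymmetric case, solves the same equation, which yields (B). With D the
negative part of the trace it gives a nonnegative trace when the data are nonnegative: where w ≥ 0
the reaction is nonnegative, and where w < 0 it is at most M times the negative part. The boundary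
term is then nonnegative and the initial term is strictly positive because G > 0, which yields (A).
The negative case follows by replacing u, u₀, h(a) with -u, -u₀, -h(-a). -/

/-- The Chebyshev-type bound `μ {σ < g} ≤ (B / σ) ^ r` that characterizes weak `L^r`. -/
def WeakBound {α : Type*} [MeasurableSpace α] (r B : ℝ) (μ : Measure α) (g : α → ℝ≥0∞) : Prop :=
  ∀ σ : ℝ, 0 < σ → μ {x | ENNReal.ofReal σ < g x} ≤ ENNReal.ofReal ((B / σ) ^ r)

/-! ### Calculus of weak Lebesgue bounds. -/

section WeakBound

variable {α : Type*} [MeasurableSpace α] {μ : Measure α}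

/-- If the superlevel set at σ had measure above some τ > (N/σ)^p, then f* ≥ σ on (0,τ), so τ^(1/p)
σ ≤ N, a contradiction. This is the only passage from the norm to distribution functions, and only
this direction is needed. -/
theorem weakBound_of_weakNorm_le {p N : ℝ} (hp : 0 < p) (hN : 0 ≤ N) {f : α → ℝ}
    (hf : weakNorm p μ f ≤ ENNReal.ofReal N) : WeakBound p N μ (fun x => ‖f x‖ₑ) := by
  intro σ hσ
  by_contra! hlt
  obtain ⟨τ, hτ0, hτ1, hτ2⟩ := ENNReal.lt_iff_exists_real_btwn.1 hlt
  have h0 : (0 : ℝ) ≤ (N / σ) ^ p := by positivity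
  have hτ3 : (N / σ) ^ p < τ := by
    by_contra! h
    exact absurd hτ1 (not_lt.2 (ENNReal.ofReal_le_ofReal h))
  have hτ : 0 < τ := lt_of_le_of_lt h0 hτ3
  have hre : ∀ s ∈ Ioo (0 : ℝ) τ, ENNReal.ofReal σ ≤ rearrangement μ f s := by
    intro s hs
    refine le_sInf fun s' hs' => ?_
    by_contra! hc
    have h1 : μ {x | ENNReal.ofReal σ < ‖f x‖ₑ} ≤ distribution μ f s' :=
      measure_mono fun x hx => hc.trans hx
    have h2 := (h1.trans hs'.2).trans (ENNReal.ofReal_le_ofReal hs.2.le)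
    exact absurd hτ2 (not_lt.2 h2)
  have havg : ENNReal.ofReal σ ≤ avgRearrangement μ f τ := by
    have h1 : ENNReal.ofReal σ * ENNReal.ofReal τ ≤ ∫⁻ s in Ioo 0 τ, rearrangement μ f s := by
      calc ENNReal.ofReal σ * ENNReal.ofReal τ = ∫⁻ _ in Ioo 0 τ, ENNReal.ofReal σ := by simp
        _ ≤ _ := setLIntegral_mono' measurableSet_Ioo hre
    have hτ' : ENNReal.ofReal τ ≠ 0 := by simpa using hτ
    calc ENNReal.ofReal σ = (ENNReal.ofReal τ)⁻¹ * (ENNReal.ofReal σ * ENNReal.ofReal τ) := by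
          rw [mul_comm (ENNReal.ofReal σ), ← mul_assoc,
            ENNReal.inv_mul_cancel hτ' ENNReal.ofReal_ne_top, one_mul]
      _ ≤ _ := by unfold avgRearrangement; gcongr
  have hmain : ENNReal.ofReal (τ ^ (1 / p) * σ) ≤ ENNReal.ofReal N := by
    rw [ENNReal.ofReal_mul (by positivity), ← ENNReal.ofReal_rpow_of_pos hτ]
    refine le_trans ?_ hf
    refine le_trans ?_ (le_iSup₂_of_le τ hτ le_rfl)
    gcongr
  rw [ENNReal.ofReal_le_ofReal_iff hN] at hmain
  have h1 : τ ^ (1 / p) ≤ N / σ := by rwa [le_div_iff₀ hσ]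
  have h2 : (τ ^ (1 / p)) ^ p ≤ (N / σ) ^ p := by gcongr
  rw [← Real.rpow_mul hτ.le, one_div_mul_cancel hp.ne', Real.rpow_one] at h2
  linarith

theorem WeakBound.mono {r A B : ℝ} {f g : α → ℝ≥0∞} (hf : WeakBound r A μ f) (hr : 0 ≤ r)
    (hA : 0 ≤ A) (hAB : A ≤ B) (hgf : ∀ᵐ x ∂μ, g x ≤ f x) : WeakBound r B μ g := by
  intro σ hσ
  calc μ {x | ENNReal.ofReal σ < g x} ≤ μ {x | ENNReal.ofReal σ < f x} := by
        refine measure_mono_ae ?_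
        filter_upwards [hgf] with x hx h
        exact lt_of_lt_of_le h hx
    _ ≤ _ := hf σ hσ
    _ ≤ _ := by gcongr

/-- If a sum exceeds σ, one summand exceeds σ/2. Superadditivity of the power r ≥ 1 merges the two
measures into one bound. -/
theorem WeakBound.add {r A B : ℝ} {f g : α → ℝ≥0∞} (hr : 1 ≤ r) (hA : 0 ≤ A) (hB : 0 ≤ B)
    (hf : WeakBound r A μ f) (hg : WeakBound r B μ g) :
    WeakBound r (2 * (A + B)) μ (fun x => f x + g x) := by
  intro σ hσ
  have hsub : {x | ENNReal.ofReal σ < f x + g x} ⊆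
      {x | ENNReal.ofReal (σ / 2) < f x} ∪ {x | ENNReal.ofReal (σ / 2) < g x} := by
    intro x hx
    by_contra hc
    simp only [mem_union, mem_ofPred_eq, not_or, not_lt] at hc hx
    have := add_le_add hc.1 hc.2
    rw [← ENNReal.ofReal_add (by positivity) (by positivity), add_halves] at this
    exact absurd hx (not_lt.2 this)
  calc _ ≤ _ := measure_mono hsub
    _ ≤ _ := measure_union_le _ _
    _ ≤ ENNReal.ofReal ((A / (σ / 2)) ^ r) + ENNReal.ofReal ((B / (σ / 2)) ^ r) :=
        add_le_add (hf _ (by positivity)) (hg _ (by positivity))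
    _ = ENNReal.ofReal ((A / (σ / 2)) ^ r + (B / (σ / 2)) ^ r) :=
        (ENNReal.ofReal_add (by positivity) (by positivity)).symm
    _ ≤ ENNReal.ofReal ((A / (σ / 2) + B / (σ / 2)) ^ r) :=
        ENNReal.ofReal_le_ofReal
          (Real.add_rpow_le_rpow_add (by positivity) (by positivity) hr)
    _ = _ := by congr 2; field_simp

theorem WeakBound.const_mul {r A c : ℝ} {f : α → ℝ≥0∞} (hc : 0 ≤ c)
    (hf : WeakBound r A μ f) :
    WeakBound r (c * A) μ (fun x => ENNReal.ofReal c * f x) := by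
  intro σ hσ
  rcases hc.eq_or_lt with rfl | hc
  · simp
  have : {x | ENNReal.ofReal σ < ENNReal.ofReal c * f x} =
      {x | ENNReal.ofReal (σ / c) < f x} := by
    ext x
    simp only [mem_ofPred_eq]
    rw [ENNReal.ofReal_div_of_pos hc, ENNReal.div_lt_iff (by simp [hc]) (by simp), mul_comm]
  rw [this]
  refine (hf _ (by positivity)).trans (le_of_eq ?_)
  congr 2
  field_simp

theorem WeakBound.rpow {q A s : ℝ} {f : α → ℝ} (hs : 0 < s) (hA : 0 ≤ A)
    (hf : WeakBound q A μ (fun x => ‖f x‖ₑ)) :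
    WeakBound (q / s) (A ^ s) μ (fun x => ‖|f x| ^ s‖ₑ) := by
  intro σ hσ
  have : {x | ENNReal.ofReal σ < ‖|f x| ^ s‖ₑ} = {x | ENNReal.ofReal (σ ^ (1 / s)) < ‖f x‖ₑ} := by
    ext x
    have h1 : σ < |f x| ^ s ↔ σ ^ (1 / s) < |f x| := by
      conv_lhs => rw [← Real.rpow_one σ, ← one_div_mul_cancel hs.ne', Real.rpow_mul hσ.le]
      exact Real.rpow_lt_rpow_iff (by positivity) (by positivity) hs
    simp only [mem_ofPred_eq, Real.enorm_eq_ofReal_abs]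
    rw [ENNReal.ofReal_lt_ofReal_iff', ENNReal.ofReal_lt_ofReal_iff',
      abs_of_nonneg (by positivity : 0 ≤ |f x| ^ s), ← h1]
    refine and_congr_right fun h => ⟨fun _ => ?_, fun _ => ?_⟩
    · exact lt_of_le_of_lt (by positivity) (h1.1 h)
    · exact hσ.trans h
  rw [this]
  refine (hf _ (by positivity)).trans (le_of_eq ?_)
  rw [Real.div_rpow hA (by positivity), Real.div_rpow (by positivity) hσ.le,
    ← Real.rpow_mul hσ.le, ← Real.rpow_mul hA]
  congr 3
  · field_simp
  · field_simp

/-- Hölder's inequality in weak Lebesgue spaces. -/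
theorem WeakBound.mul {m q r A B : ℝ} {f g : α → ℝ≥0∞} (hm : 0 < m) (hq : 0 < q) (hr : 1 ≤ r)
    (hmqr : 1 / r = 1 / m + 1 / q) (hA : 0 < A) (hB : 0 < B)
    (hf : WeakBound m A μ f) (hg : WeakBound q B μ g) :
    WeakBound r (2 * (A * B)) μ (fun x => f x * g x) := by
  intro σ hσ
  have hr0 : 0 < r := by linarith
  set b : ℝ := A * B / σ with hb
  have hbpos : 0 < b := by positivity
  -- If fg > σ, then f > a or g > σ/a. This level a makes both distribution bounds equal to b^r.
  set a : ℝ := A / b ^ (r / m) with ha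
  have hapos : 0 < a := by positivity
  have hsub : {x | ENNReal.ofReal σ < f x * g x} ⊆
      {x | ENNReal.ofReal a < f x} ∪ {x | ENNReal.ofReal (σ / a) < g x} := by
    intro x hx
    by_contra hc
    simp only [mem_union, mem_ofPred_eq, not_or, not_lt] at hc hx
    have := mul_le_mul' hc.1 hc.2
    rw [← ENNReal.ofReal_mul hapos.le, mul_div_cancel₀ _ hapos.ne'] at this
    exact absurd hx (not_lt.2 this)
  have h1 : (A / a) ^ m = b ^ r := by
    have : A / a = b ^ (r / m) := by rw [ha]; field_simp
    rw [this, ← Real.rpow_mul hbpos.le]; congr 1; field_simp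
  have h2 : (B / (σ / a)) ^ q = b ^ r := by
    have : B / (σ / a) = b ^ (r / q) := by
      have h3 : r / q = 1 - r / m := by
        have : r * (1 / r) = r * (1 / m + 1 / q) := by rw [hmqr]
        rw [mul_one_div_cancel hr0.ne'] at this
        have h4 : r / q = r * (1 / q) := by ring
        have h5 : r / m = r * (1 / m) := by ring
        rw [h4, h5]; linarith
      rw [h3, Real.rpow_sub hbpos, Real.rpow_one, ha, hb]; field_simp
    rw [this, ← Real.rpow_mul hbpos.le]; congr 1; field_simp
  calc _ ≤ _ := measure_mono hsub
    _ ≤ _ := measure_union_le _ _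
    _ ≤ ENNReal.ofReal ((A / a) ^ m) + ENNReal.ofReal ((B / (σ / a)) ^ q) :=
        add_le_add (hf _ (by positivity)) (hg _ (by positivity))
    _ = ENNReal.ofReal (b ^ r + b ^ r) := by
        rw [h1, h2, ENNReal.ofReal_add (by positivity) (by positivity)]
    _ ≤ ENNReal.ofReal ((b + b) ^ r) :=
        ENNReal.ofReal_le_ofReal
          (Real.add_rpow_le_rpow_add (by positivity) (by positivity) hr)
    _ = _ := by congr 2; rw [hb]; ring

theorem WeakBound.ae_lt_top {r A : ℝ} {f : α → ℝ≥0∞} (hr : 0 < r) (hf : WeakBound r A μ f) :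
    ∀ᵐ x ∂μ, f x < ∞ := by
  have hle : ∀ k : ℕ, μ {x | ¬ f x < ∞} ≤ ENNReal.ofReal ((A / ((k : ℝ) + 1)) ^ r) := by
    intro k
    refine (measure_mono ?_).trans (hf ((k : ℝ) + 1) (by positivity))
    intro x hx
    simp only [mem_ofPred_eq, not_lt, top_le_iff] at hx ⊢
    rw [hx]; exact ENNReal.ofReal_lt_top
  have hlim : Tendsto (fun k : ℕ => ENNReal.ofReal ((A / ((k : ℝ) + 1)) ^ r)) atTop (𝓝 0) := by
    have h1 : Tendsto (fun k : ℕ => A / ((k : ℝ) + 1)) atTop (𝓝 0) :=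
      tendsto_const_nhds.div_atTop
        (tendsto_atTop_add_const_right _ _ tendsto_natCast_atTop_atTop)
    have h2 := ENNReal.tendsto_ofReal ((h1.rpow_const (p := r) (Or.inr hr.le)))
    simpa [Real.zero_rpow hr.ne'] using h2
  exact le_antisymm (ge_of_tendsto' hlim hle) bot_le

/-- Letting k tend to infinity makes every superlevel set null. -/
theorem ae_eq_zero_of_weakBound {r A θ : ℝ} {f : α → ℝ≥0∞} (hr : 0 < r) (hθ0 : 0 ≤ θ) (hθ : θ < 1)
    (hf : ∀ k : ℕ, WeakBound r (θ ^ k * A) μ f) : ∀ᵐ x ∂μ, f x = 0 := by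
  have hz : ∀ σ : ℝ, 0 < σ → μ {x | ENNReal.ofReal σ < f x} = 0 := by
    intro σ hσ
    have hlim : Tendsto (fun k : ℕ => ENNReal.ofReal ((θ ^ k * A / σ) ^ r)) atTop (𝓝 0) := by
      have h1 : Tendsto (fun k : ℕ => θ ^ k * A / σ) atTop (𝓝 0) := by
        simpa using ((tendsto_pow_atTop_nhds_zero_of_lt_one hθ0 hθ).mul_const A).div_const σ
      have h2 := ENNReal.tendsto_ofReal ((h1.rpow_const (p := r) (Or.inr hr.le)))
      simpa [Real.zero_rpow hr.ne'] using h2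
    exact le_antisymm (ge_of_tendsto' hlim fun k => hf k σ hσ) bot_le
  have hall : ∀ᵐ x ∂μ, ∀ k : ℕ, f x ≤ ENNReal.ofReal (1 / ((k : ℝ) + 1)) := by
    rw [ae_all_iff]
    intro k
    have := hz (1 / ((k : ℝ) + 1)) (by positivity)
    rw [ae_iff]
    simpa only [not_le] using this
  filter_upwards [hall] with x hx
  have hlim : Tendsto (fun k : ℕ => ENNReal.ofReal (1 / ((k : ℝ) + 1))) atTop (𝓝 0) := by
    simpa using ENNReal.tendsto_ofReal tendsto_one_div_add_atTop_nhds_zero_nat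
  exact le_antisymm (ge_of_tendsto' hlim hx) bot_le

/-- The mass above level `a` of a function in weak `L^r`, `r > 1`. -/
theorem WeakBound.lintegral_indicator_le {r B a : ℝ} {g : α → ℝ} (hg : AEMeasurable g μ)
    (hr : 1 < r) (hB : 0 < B) (ha : 0 < a) (h : WeakBound r B μ (fun x => ‖g x‖ₑ)) :
    ∫⁻ x, {x | ENNReal.ofReal a < ‖g x‖ₑ}.indicator (fun x => ‖g x‖ₑ) x ∂μ ≤
      ENNReal.ofReal (2 * 2 ^ r * (1 - 2 ^ (1 - r))⁻¹ * (B ^ r * a ^ (1 - r))) := by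
  -- Dyadic layers above a. The threshold is halved because the layer containing |g| satisfies only
  -- 2^k a ≤ |g|, while S k asks for a strict inequality. The layers sum geometrically since r > 1.
  set S : ℕ → Set α := fun k => {x | ENNReal.ofReal (2 ^ k * a / 2) < ‖g x‖ₑ} with hS
  have hSm : ∀ k, NullMeasurableSet (S k) μ := fun k =>
    nullMeasurableSet_lt aemeasurable_const hg.enorm
  have hpt : ∀ x, {x | ENNReal.ofReal a < ‖g x‖ₑ}.indicator (fun x => ‖g x‖ₑ) x ≤
      ∑' k, (S k).indicator (fun _ => ENNReal.ofReal (2 ^ (k + 1) * a)) x := by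
    intro x
    by_cases hx : ENNReal.ofReal a < ‖g x‖ₑ
    · rw [indicator_of_mem (show x ∈ {x | ENNReal.ofReal a < ‖g x‖ₑ} from hx)]
      rw [Real.enorm_eq_ofReal_abs] at hx ⊢
      have hx' : a < |g x| := by
        rw [ENNReal.ofReal_lt_ofReal_iff'] at hx; exact hx.1
      obtain ⟨k, hk1, hk2⟩ := exists_nat_pow_near (x := |g x| / a) (y := (2 : ℝ))
        (by rw [le_div_iff₀ ha]; linarith) (by norm_num)
      rw [le_div_iff₀ ha] at hk1
      rw [div_lt_iff₀ ha] at hk2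
      refine le_trans ?_ (ENNReal.le_tsum k)
      rw [indicator_of_mem]
      · exact ENNReal.ofReal_le_ofReal hk2.le
      · have : (0 : ℝ) < 2 ^ k * a := by positivity
        simp only [hS, mem_ofPred_eq, Real.enorm_eq_ofReal_abs]
        rw [ENNReal.ofReal_lt_ofReal_iff (by linarith)]
        linarith
    · rw [indicator_of_notMem (show x ∉ {x | ENNReal.ofReal a < ‖g x‖ₑ} from hx)]
      exact bot_le
  have hgeo0 : (0 : ℝ) < 2 ^ (1 - r) := by positivity
  have hgeo1 : (2 : ℝ) ^ (1 - r) < 1 := Real.rpow_lt_one_of_one_lt_of_neg (by norm_num) (by linarith)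
  have hterm : ∀ k : ℕ, ENNReal.ofReal (2 ^ (k + 1) * a) * μ (S k) ≤
      ENNReal.ofReal (2 * 2 ^ r * (B ^ r * a ^ (1 - r)) * (2 ^ (1 - r)) ^ k) := by
    intro k
    have hk : (0 : ℝ) < 2 ^ k := by positivity
    calc _ ≤ ENNReal.ofReal (2 ^ (k + 1) * a) * ENNReal.ofReal ((B / (2 ^ k * a / 2)) ^ r) := by
          gcongr; exact h _ (by positivity)
      _ = _ := by
          rw [← ENNReal.ofReal_mul (by positivity)]
          congr 1
          have e1 : ((2 : ℝ) ^ (1 - r)) ^ k = 2 ^ k / (2 ^ k) ^ r := by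
            rw [← Real.rpow_natCast, ← Real.rpow_mul (by norm_num), mul_comm,
              Real.rpow_mul (by norm_num), Real.rpow_natCast, Real.rpow_sub hk, Real.rpow_one]
          rw [e1, Real.rpow_sub ha, Real.rpow_one,
            show B / (2 ^ k * a / 2) = 2 * B / (2 ^ k * a) by field_simp,
            Real.div_rpow (by positivity) (by positivity), Real.mul_rpow (by positivity) hB.le,
            Real.mul_rpow hk.le ha.le, pow_succ]
          field_simp
  calc _ ≤ ∫⁻ x, ∑' k, (S k).indicator (fun _ => ENNReal.ofReal (2 ^ (k + 1) * a)) x ∂μ :=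
        lintegral_mono hpt
    _ = ∑' k, ENNReal.ofReal (2 ^ (k + 1) * a) * μ (S k) := by
        rw [lintegral_tsum fun k => aemeasurable_const.indicator₀ (hSm k)]
        refine tsum_congr fun k => ?_
        rw [lintegral_indicator_const₀ (hSm k)]
    _ ≤ ∑' k : ℕ, ENNReal.ofReal (2 * 2 ^ r * (B ^ r * a ^ (1 - r)) * (2 ^ (1 - r)) ^ k) :=
        ENNReal.tsum_le_tsum hterm
    _ = _ := by
        rw [← ENNReal.ofReal_tsum_of_nonneg (fun k => by positivity)
          ((summable_geometric_of_lt_one hgeo0.le hgeo1).mul_left _), tsum_mul_left,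
          tsum_geometric_of_lt_one hgeo0.le hgeo1]
        congr 1; ring

end WeakBound

/-- The constant in `WeakBound.lintegral_indicator_le`. -/
noncomputable def tailConst (r : ℝ) : ℝ := 2 * 2 ^ r * (1 - 2 ^ (1 - r))⁻¹

theorem tailConst_pos {r : ℝ} (hr : 1 < r) : 0 < tailConst r := by
  have : (2 : ℝ) ^ (1 - r) < 1 := Real.rpow_lt_one_of_one_lt_of_neg (by norm_num) (by linarith)
  have : (0 : ℝ) < 1 - 2 ^ (1 - r) := by linarith
  unfold tailConst
  positivity

/-! ### Weak-type estimate for the boundary heat potential. -/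

/-- The bounds on the heat kernel on the boundary of a half-space whose boundary has dimension
`m`. -/
structure IsHeatLike {E : Type*} [MeasurableSpace E] (μ : Measure E) (m c : ℝ)
    (K : ℝ → E → E → ℝ≥0∞) : Prop where
  measurable : Measurable fun z : ℝ × E × E => K z.1 z.2.1 z.2.2
  lintegral_right_le : ∀ τ, 0 < τ → ∀ x, ∫⁻ y, K τ x y ∂μ ≤ ENNReal.ofReal (c * τ ^ (-(1 / 2) : ℝ))
  lintegral_left_le : ∀ τ, 0 < τ → ∀ y, ∫⁻ x, K τ x y ∂μ ≤ ENNReal.ofReal (c * τ ^ (-(1 / 2) : ℝ))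
  le : ∀ τ, 0 < τ → ∀ x y, K τ x y ≤ ENNReal.ofReal (c * τ ^ (-((m + 1) / 2)))

theorem enorm_le_add_indicator {α : Type*} (g : α → ℝ) (a : ℝ) (y : α) :
    ‖g y‖ₑ ≤ ENNReal.ofReal a +
      {y | ENNReal.ofReal a < ‖g y‖ₑ}.indicator (fun y => ‖g y‖ₑ) y := by
  by_cases h : ENNReal.ofReal a < ‖g y‖ₑ
  · rw [indicator_of_mem (show y ∈ {y | ENNReal.ofReal a < ‖g y‖ₑ} from h)]
    exact le_add_self
  · exact (not_lt.1 h).trans le_self_add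

theorem lintegral_Ioc_rpow_neg_half {c L : ℝ} (hc : 0 ≤ c) (hL : 0 < L) :
    ∫⁻ τ in Ioc 0 L, ENNReal.ofReal (c * τ ^ (-(1 / 2) : ℝ)) =
      ENNReal.ofReal (2 * c * L ^ (1 / 2 : ℝ)) := by
  have hint : IntervalIntegrable (fun τ : ℝ => τ ^ (-(1 / 2) : ℝ)) volume 0 L :=
    intervalIntegral.intervalIntegrable_rpow' (by norm_num)
  rw [intervalIntegrable_iff_integrableOn_Ioc_of_le hL.le] at hint
  rw [← ofReal_integral_eq_lintegral_ofReal (hint.const_mul c), integral_const_mul,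
    ← intervalIntegral.integral_of_le hL.le, integral_rpow (Or.inl (by norm_num))]
  · congr 1
    norm_num
    ring
  · filter_upwards [ae_restrict_mem measurableSet_Ioc] with τ hτ
    have := hτ.1
    simp only [Pi.zero_apply]
    positivity

theorem lintegral_Ioi_rpow_of_lt {c L b : ℝ} (hc : 0 ≤ c) (hL : 0 < L) (hb : 0 < b) :
    ∫⁻ τ in Ioi L, ENNReal.ofReal (c * τ ^ (-1 - b)) = ENNReal.ofReal (c * (L ^ (-b) / b)) := by
  have hint := integrableOn_Ioi_rpow_of_lt (a := -1 - b) (by linarith) hL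
  rw [← ofReal_integral_eq_lintegral_ofReal (hint.const_mul c), integral_const_mul,
    integral_Ioi_rpow_of_lt (by linarith) hL]
  · congr 1
    rw [show -1 - b + 1 = -b by ring, neg_div_neg_eq]
  · filter_upwards [ae_restrict_mem measurableSet_Ioi] with τ hτ
    have : 0 < τ := hL.trans hτ
    simp only [Pi.zero_apply]
    positivity

section potential

variable {E : Type*} [MeasurableSpace E] {μ : Measure E} {m c q r : ℝ}
  {K : ℝ → E → E → ℝ≥0∞}

/-- Values below a are charged to the mass of the kernel; only the tail above a remains. -/
theorem IsHeatLike.lintegral_mul_enorm_le (hK : IsHeatLike μ m c K) {a τ : ℝ}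
    (hc : 0 < c) (hτ : 0 < τ) (g : E → ℝ) (x : E) :
    ∫⁻ y, K τ x y * ‖g y‖ₑ ∂μ ≤ ENNReal.ofReal (c * a * τ ^ (-(1 / 2) : ℝ)) +
      ∫⁻ y, K τ x y * {y | ENNReal.ofReal a < ‖g y‖ₑ}.indicator (fun y => ‖g y‖ₑ) y ∂μ := by
  have hm : Measurable fun y => K τ x y :=
    hK.measurable.comp (measurable_const.prodMk (measurable_const.prodMk measurable_id))
  calc _ ≤ ∫⁻ y, (K τ x y * ENNReal.ofReal a +
        K τ x y * {y | ENNReal.ofReal a < ‖g y‖ₑ}.indicator (fun y => ‖g y‖ₑ) y) ∂μ := by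
        refine lintegral_mono fun y => ?_
        dsimp only
        rw [← mul_add]
        gcongr
        exact enorm_le_add_indicator g a y
    _ = (∫⁻ y, K τ x y ∂μ) * ENNReal.ofReal a + _ := by
        rw [lintegral_add_left (hm.mul_const _), lintegral_mul_const _ hm]
    _ ≤ _ := by
        gcongr
        refine (mul_le_mul_left (hK.lintegral_right_le τ hτ x) _).trans (le_of_eq ?_)
        rw [← ENNReal.ofReal_mul (by positivity)]
        congr 1; ring

/-- Smoothing from weak L^r to bounded functions: the low values use the kernel's mass, the tail
uses its supremum and the integrability above a level. -/
theorem IsHeatLike.lintegral_mul_enorm_le_of_weakBound (hK : IsHeatLike μ m c K) {B τ : ℝ}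
    (hc : 0 < c) (hr : 1 < r) (hB : 0 < B) (hτ : 0 < τ) {g : E → ℝ} (hg : AEMeasurable g μ)
    (h : WeakBound r B μ (fun y => ‖g y‖ₑ)) (x : E) :
    ∫⁻ y, K τ x y * ‖g y‖ₑ ∂μ ≤
      ENNReal.ofReal (c * (1 + tailConst r) * B * τ ^ (-(1 / 2) - m / (2 * r))) := by
  have hr0 : 0 < r := by linarith
  have hC := tailConst_pos hr
  -- The level at which the low and high parts have the same power of τ.
  set a : ℝ := B * τ ^ (-(m / (2 * r))) with ha
  have hapos : 0 < a := by positivity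
  have htail : ∫⁻ y, K τ x y * {y | ENNReal.ofReal a < ‖g y‖ₑ}.indicator (fun y => ‖g y‖ₑ) y ∂μ ≤
      ENNReal.ofReal (c * τ ^ (-((m + 1) / 2)) * (tailConst r * (B ^ r * a ^ (1 - r)))) := by
    calc _ ≤ ∫⁻ y, ENNReal.ofReal (c * τ ^ (-((m + 1) / 2))) *
          {y | ENNReal.ofReal a < ‖g y‖ₑ}.indicator (fun y => ‖g y‖ₑ) y ∂μ := by
          refine lintegral_mono fun y => ?_
          exact mul_le_mul_left (hK.le τ hτ x y) _
      _ = ENNReal.ofReal (c * τ ^ (-((m + 1) / 2))) * _ :=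
          lintegral_const_mul' _ _ ENNReal.ofReal_ne_top
      _ ≤ _ := by
          rw [ENNReal.ofReal_mul (p := c * τ ^ (-((m + 1) / 2))) (by positivity)]
          gcongr
          exact h.lintegral_indicator_le hg hr hB hapos
  refine (hK.lintegral_mul_enorm_le (a := a) hc hτ g x).trans ?_
  refine (add_le_add_right htail _).trans (le_of_eq ?_)
  rw [← ENNReal.ofReal_add (by positivity) (by positivity)]
  congr 1
  have e1 : a * τ ^ (-(1 / 2) : ℝ) = B * τ ^ (-(1 / 2) - m / (2 * r)) := by
    rw [ha, mul_assoc, ← Real.rpow_add hτ]; congr 2; ring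
  have e2 : τ ^ (-((m + 1) / 2)) * (B ^ r * a ^ (1 - r)) =
      B * τ ^ (-(1 / 2) - m / (2 * r)) := by
    rw [ha, Real.mul_rpow hB.le (by positivity), ← Real.rpow_mul hτ.le, ← mul_assoc (B ^ r),
      ← Real.rpow_add hB, mul_left_comm, ← Real.rpow_add hτ,
      show r + (1 - r) = 1 by ring, Real.rpow_one]
    congr 2
    field_simp
    ring
  calc _ = c * (a * τ ^ (-(1 / 2) : ℝ)) +
        c * tailConst r * (τ ^ (-((m + 1) / 2)) * (B ^ r * a ^ (1 - r))) := by ring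
    _ = _ := by rw [e1, e2]; ring

/-- The part of the heat potential of `f` that comes from times less than `L` before the present
and from the values of `f` above the level `a`. -/
noncomputable def nearPotential (μ : Measure E) (K : ℝ → E → E → ℝ≥0∞) (f : ℝ × E → ℝ)
    (a L t : ℝ) (x : E) : ℝ≥0∞ :=
  ∫⁻ s in Ioo 0 t, (Ioc 0 L).indicator (fun _ => 1) (t - s) * ∫⁻ y, K (t - s) x y *
    {y | ENNReal.ofReal a < ‖f (s, y)‖ₑ}.indicator (fun y => ‖f (s, y)‖ₑ) y ∂μ

theorem measurable_tail {f : ℝ × E → ℝ} (hf : Measurable f) (a : ℝ) :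
    Measurable fun z : ℝ × E =>
      {y | ENNReal.ofReal a < ‖f (z.1, y)‖ₑ}.indicator (fun y => ‖f (z.1, y)‖ₑ) z.2 := by
  have : (fun z : ℝ × E => {y | ENNReal.ofReal a < ‖f (z.1, y)‖ₑ}.indicator
      (fun y => ‖f (z.1, y)‖ₑ) z.2) =
      {z | ENNReal.ofReal a < ‖f z‖ₑ}.indicator (fun z => ‖f z‖ₑ) := by
    ext z; simp [indicator]
  rw [this]
  exact hf.enorm.indicator (measurableSet_lt measurable_const hf.enorm)

theorem IsHeatLike.measurable_mul_tail (hK : IsHeatLike μ m c K) {f : ℝ × E → ℝ}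
    (hf : Measurable f) (a t : ℝ) :
    Measurable fun z : (E × ℝ) × E => K (t - z.1.2) z.1.1 z.2 *
      {y | ENNReal.ofReal a < ‖f (z.1.2, y)‖ₑ}.indicator (fun y => ‖f (z.1.2, y)‖ₑ) z.2 := by
  refine Measurable.mul ?_ ?_
  · exact hK.measurable.comp (((measurable_const.sub measurable_fst.snd)).prodMk
      (measurable_fst.fst.prodMk measurable_snd))
  · exact (measurable_tail hf a).comp (measurable_fst.snd.prodMk measurable_snd)

/-- Lags beyond L are handled by smoothing, whose rate τ^(-1-m/(2q)) is integrable at infinity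
though not at 0. For lags up to L, the low values cost a·τ^(-1/2), integrable at 0, and the high
values are left in `nearPotential`. -/
theorem IsHeatLike.potential_le (hK : IsHeatLike μ m c K) {B a L t : ℝ} (hm : 0 < m) (hc : 0 < c)
    (hq : 0 < q) (hr : 1 < r) (hmqr : 1 / r = 1 / m + 1 / q) (hB : 0 < B) (ha : 0 < a) (hL : 0 < L)
    {f : ℝ × E → ℝ} (hf : Measurable f)
    (h : ∀ᵐ s ∂volume.restrict (Ioo 0 t), WeakBound r B μ (fun y => ‖f (s, y)‖ₑ)) (x : E) :
    ∫⁻ s in Ioo 0 t, ∫⁻ y, K (t - s) x y * ‖f (s, y)‖ₑ ∂μ ≤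
      ENNReal.ofReal (2 * (c * a) * L ^ (1 / 2 : ℝ) +
        c * (1 + tailConst r) * B * (L ^ (-(m / (2 * q))) / (m / (2 * q)))) +
      nearPotential μ K f a L t x := by
  have hC := tailConst_pos hr
  set ψ₁ : ℝ → ℝ≥0∞ := (Ioc 0 L).indicator fun τ =>
    ENNReal.ofReal (c * a * τ ^ (-(1 / 2) : ℝ)) with hψ₁
  set ψ₂ : ℝ → ℝ≥0∞ := (Ioi L).indicator fun τ =>
    ENNReal.ofReal (c * (1 + tailConst r) * B * τ ^ (-1 - m / (2 * q))) with hψ₂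
  have hψ₁m : Measurable ψ₁ := Measurable.indicator (by fun_prop) measurableSet_Ioc
  have hψ₂m : Measurable ψ₂ := Measurable.indicator (by fun_prop) measurableSet_Ioi
  have hexp : -(1 / 2) - m / (2 * r) = -1 - m / (2 * q) := by
    have h1 : m / (2 * r) = m / 2 * (1 / r) := by field_simp
    rw [h1, hmqr]; field_simp; ring
  have hsub : Measurable fun s : ℝ => t - s := measurable_const.sub measurable_id
  calc _ ≤ ∫⁻ s in Ioo 0 t, ((ψ₁ (t - s) + ψ₂ (t - s)) +
        (Ioc 0 L).indicator (fun _ => 1) (t - s) * ∫⁻ y, K (t - s) x y *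
        {y | ENNReal.ofReal a < ‖f (s, y)‖ₑ}.indicator (fun y => ‖f (s, y)‖ₑ) y ∂μ) := by
        refine lintegral_mono_ae ?_
        filter_upwards [h, ae_restrict_mem measurableSet_Ioo] with s hs hst
        have hτ : 0 < t - s := by linarith [hst.2]
        have hgm : Measurable fun y => f (s, y) := hf.comp measurable_prodMk_left
        by_cases hin : t - s ≤ L
        · have hin' : t - s ∈ Ioc 0 L := ⟨hτ, hin⟩
          rw [indicator_of_mem hin', one_mul, hψ₁, indicator_of_mem hin']
          refine (hK.lintegral_mul_enorm_le (a := a) hc hτ _ x).trans ?_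
          gcongr
          exact le_self_add
        · have hin' : t - s ∈ Ioi L := not_le.1 hin
          rw [hψ₂, indicator_of_mem hin', ← hexp]
          refine (hK.lintegral_mul_enorm_le_of_weakBound hc hr hB hτ hgm.aemeasurable hs x).trans ?_
          exact le_add_right le_add_self
    _ = (∫⁻ s in Ioo 0 t, (ψ₁ (t - s) + ψ₂ (t - s))) + _ :=
        lintegral_add_left ((hψ₁m.comp hsub).add (hψ₂m.comp hsub)) _
    _ ≤ _ := by
        refine add_le_add ?_ le_rfl
        -- Extending to the whole line and reflecting the time variable gives a bound independent of
        -- t.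
        calc _ ≤ ∫⁻ s, (ψ₁ (t - s) + ψ₂ (t - s)) := setLIntegral_le_lintegral _ _
          _ = (∫⁻ s, ψ₁ (t - s)) + ∫⁻ s, ψ₂ (t - s) := lintegral_add_left (hψ₁m.comp hsub) _
          _ = (∫⁻ s, ψ₁ s) + ∫⁻ s, ψ₂ s := by
              rw [lintegral_sub_left_eq_self, lintegral_sub_left_eq_self]
          _ = _ := by
              rw [hψ₁, hψ₂, lintegral_indicator measurableSet_Ioc,
                lintegral_indicator measurableSet_Ioi, lintegral_Ioc_rpow_neg_half (by positivity) hL,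
                lintegral_Ioi_rpow_of_lt (by positivity) hL (by positivity),
                ENNReal.ofReal_add (by positivity) (by positivity)]

variable [SFinite μ]

theorem IsHeatLike.measurable_nearPotential_integrand (hK : IsHeatLike μ m c K) {f : ℝ × E → ℝ}
    (hf : Measurable f) (a L t : ℝ) :
    Measurable fun z : E × ℝ => (Ioc 0 L).indicator (fun _ => (1 : ℝ≥0∞)) (t - z.2) *
      ∫⁻ y, K (t - z.2) z.1 y *
      {y | ENNReal.ofReal a < ‖f (z.2, y)‖ₑ}.indicator (fun y => ‖f (z.2, y)‖ₑ) y ∂μ := by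
  have hone : Measurable fun s : ℝ => (Ioc 0 L).indicator (fun _ => (1 : ℝ≥0∞)) (t - s) :=
    (measurable_one.indicator measurableSet_Ioc).comp (measurable_const.sub measurable_id)
  exact (hone.comp measurable_snd).mul (hK.measurable_mul_tail hf a t).lintegral_prod_right'

theorem IsHeatLike.measurable_nearPotential (hK : IsHeatLike μ m c K) {f : ℝ × E → ℝ}
    (hf : Measurable f) (a L t : ℝ) : Measurable (nearPotential μ K f a L t) :=
  (hK.measurable_nearPotential_integrand hf a L t).lintegral_prod_right'

/-- By Tonelli the kernel is integrated in x first, with mass of order τ^(-1/2). The tail of f(s, ·)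
has a bound independent of s, and the lags in (0, L] contribute L^(1/2). -/
theorem IsHeatLike.lintegral_nearPotential_le (hK : IsHeatLike μ m c K) {B a L t : ℝ} (hc : 0 < c)
    (hr : 1 < r) (hB : 0 < B) (ha : 0 < a) (hL : 0 < L)
    {f : ℝ × E → ℝ} (hf : Measurable f)
    (h : ∀ᵐ s ∂volume.restrict (Ioo 0 t), WeakBound r B μ (fun y => ‖f (s, y)‖ₑ)) :
    ∫⁻ x, nearPotential μ K f a L t x ∂μ ≤
      ENNReal.ofReal (2 * c * L ^ (1 / 2 : ℝ) * (tailConst r * (B ^ r * a ^ (1 - r)))) := by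
  have hC := tailConst_pos hr
  have hfi := measurable_tail hf a
  have hj := hK.measurable_mul_tail hf a t
  have hj2 := hK.measurable_nearPotential_integrand hf a L t
  unfold nearPotential
  rw [lintegral_lintegral_swap hj2.aemeasurable]
  set ψ : ℝ → ℝ≥0∞ := (Ioc 0 L).indicator fun τ => ENNReal.ofReal (c * τ ^ (-(1 / 2) : ℝ)) with hψ
  have hψm : Measurable ψ := Measurable.indicator (by fun_prop) measurableSet_Ioc
  set D : ℝ≥0∞ := ENNReal.ofReal (tailConst r * (B ^ r * a ^ (1 - r))) with hD
  calc _ ≤ ∫⁻ s in Ioo 0 t, ψ (t - s) * D := by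
        refine lintegral_mono_ae ?_
        filter_upwards [h, ae_restrict_mem measurableSet_Ioo] with s hs hst
        have hτ : 0 < t - s := by linarith [hst.2]
        have hgm : Measurable fun y => f (s, y) := hf.comp measurable_prodMk_left
        have hjs : Measurable fun z : E × E => K (t - s) z.1 z.2 *
            {y | ENNReal.ofReal a < ‖f (s, y)‖ₑ}.indicator (fun y => ‖f (s, y)‖ₑ) z.2 :=
          hj.comp (f := fun z : E × E => ((z.1, s), z.2))
          ((measurable_fst.prodMk measurable_const).prodMk measurable_snd)
        have hfis : Measurable fun y =>
            {y | ENNReal.ofReal a < ‖f (s, y)‖ₑ}.indicator (fun y => ‖f (s, y)‖ₑ) y :=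
          hfi.comp (measurable_prodMk_left (x := s))
        rw [lintegral_const_mul _ hjs.lintegral_prod_right']
        by_cases hin : t - s ∈ Ioc 0 L
        · rw [hψ, indicator_of_mem hin, indicator_of_mem hin, one_mul,
            lintegral_lintegral_swap hjs.aemeasurable]
          calc _ ≤ ∫⁻ y, ENNReal.ofReal (c * (t - s) ^ (-(1 / 2) : ℝ)) *
                {y | ENNReal.ofReal a < ‖f (s, y)‖ₑ}.indicator (fun y => ‖f (s, y)‖ₑ) y ∂μ := by
                refine lintegral_mono fun y => ?_
                dsimp only
                rw [lintegral_mul_const]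
                · gcongr
                  exact hK.lintegral_left_le _ hτ y
                · exact hK.measurable.comp (measurable_const.prodMk
                    (measurable_id.prodMk measurable_const))
            _ = ENNReal.ofReal (c * (t - s) ^ (-(1 / 2) : ℝ)) * _ := lintegral_const_mul _ hfis
            _ ≤ _ := by
                gcongr
                exact hs.lintegral_indicator_le hgm.aemeasurable hr hB ha
        · rw [indicator_of_notMem hin, zero_mul]
          exact bot_le
    _ ≤ ∫⁻ s, ψ (t - s) * D := setLIntegral_le_lintegral _ _
    _ = (∫⁻ s, ψ (t - s)) * D :=
        lintegral_mul_const _ (hψm.comp (measurable_const.sub measurable_id))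
    _ = (∫⁻ τ, ψ τ) * D := by rw [lintegral_sub_left_eq_self]
    _ = _ := by
        rw [hψ, lintegral_indicator measurableSet_Ioc, lintegral_Ioc_rpow_neg_half hc.le hL, hD,
          ← ENNReal.ofReal_mul (by positivity)]

/-- The boundary heat potential maps bounded curves in weak `L^r` to bounded curves in weak `L^q`
when `1 / q = 1 / r - 1 / m > 0`. -/
theorem IsHeatLike.exists_weakBound_potential (hK : IsHeatLike μ m c K) (hm : 0 < m) (hc : 0 < c)
    (hq : 0 < q) (hr : 1 < r) (hmqr : 1 / r = 1 / m + 1 / q) :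
    ∃ C : ℝ, 0 < C ∧ ∀ (B t : ℝ) (f : ℝ × E → ℝ), 0 < B → Measurable f →
      (∀ᵐ s ∂volume.restrict (Ioo 0 t), WeakBound r B μ (fun y => ‖f (s, y)‖ₑ)) →
      WeakBound q (C * B) μ fun x =>
        ∫⁻ s in Ioo 0 t, ∫⁻ y, K (t - s) x y * ‖f (s, y)‖ₑ ∂μ := by
  have hC := tailConst_pos hr
  have hr0 : 0 < r := by linarith
  set κ : ℝ := c * (1 + tailConst r) / (m / (2 * q)) with hκ
  have hκpos : 0 < κ := by positivity
  set A : ℝ := 4 * c * (tailConst r * (8 * c) ^ (r - 1)) * (4 * κ) ^ (q * r / m) with hA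
  have hApos : 0 < A := by positivity
  refine ⟨A ^ (1 / q), by positivity, fun B t f hB hf h σ hσ => ?_⟩
  set β : ℝ := B / σ with hβ
  have hβpos : 0 < β := by positivity
  -- With L = ℓ², this ℓ makes the long-lag part equal to σ/4, and the level a below makes the
  -- low-value part σ/4 too. Exceeding σ then forces `nearPotential` to be at least σ/2.
  set ℓ : ℝ := (4 * κ * β) ^ (q / m) with hℓ
  have hℓpos : 0 < ℓ := by positivity
  set a : ℝ := σ / (8 * c * ℓ) with ha
  have hapos : 0 < a := by positivity
  have hL : (ℓ ^ 2) ^ (1 / 2 : ℝ) = ℓ := by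
    rw [← Real.rpow_natCast, ← Real.rpow_mul hℓpos.le]; norm_num
  have hL2 : (ℓ ^ 2) ^ (-(m / (2 * q))) = (4 * κ * β)⁻¹ := by
    rw [← Real.rpow_natCast, ← Real.rpow_mul hℓpos.le, hℓ, ← Real.rpow_mul (by positivity),
      ← Real.rpow_neg_one]
    congr 1
    push_cast
    field_simp
  set H : E → ℝ≥0∞ := nearPotential μ K f a (ℓ ^ 2) t with hH
  have hle : ∀ x, ∫⁻ s in Ioo 0 t, ∫⁻ y, K (t - s) x y * ‖f (s, y)‖ₑ ∂μ ≤
      ENNReal.ofReal (σ / 2) + H x := by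
    intro x
    refine (hK.potential_le hm hc hq hr hmqr hB hapos (pow_pos hℓpos 2) hf h x).trans (le_of_eq ?_)
    congr 2
    rw [hL, hL2, ha]
    have e : c * (1 + tailConst r) * B * ((4 * κ * β)⁻¹ / (m / (2 * q))) =
        κ * B * (4 * κ * β)⁻¹ := by rw [hκ]; ring
    rw [e, hβ]
    field_simp
    norm_num
  have hHint := hK.lintegral_nearPotential_le hc hr hB hapos (pow_pos hℓpos 2) hf h
  have hcheb : ENNReal.ofReal (σ / 2) * μ {x | ENNReal.ofReal (σ / 2) ≤ H x} ≤ ∫⁻ x, H x ∂μ :=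
    mul_meas_ge_le_lintegral (hK.measurable_nearPotential hf _ _ _) _
  have hsub : {x | ENNReal.ofReal σ < ∫⁻ s in Ioo 0 t, ∫⁻ y, K (t - s) x y * ‖f (s, y)‖ₑ ∂μ} ⊆
      {x | ENNReal.ofReal (σ / 2) ≤ H x} := by
    intro x hx
    by_contra hc
    simp only [mem_ofPred_eq, not_le] at hc hx
    have h1 := ENNReal.add_lt_add_left (a := ENNReal.ofReal (σ / 2)) ENNReal.ofReal_ne_top hc
    rw [← ENNReal.ofReal_add (by positivity) (by positivity), add_halves] at h1
    exact absurd (hx.trans_le (hle x)) (not_lt.2 h1.le)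
  refine (measure_mono hsub).trans ?_
  have hσ0 : ENNReal.ofReal (σ / 2) ≠ 0 := by simpa using hσ
  rw [mul_comm, ← ENNReal.le_div_iff_mul_le (Or.inl hσ0) (Or.inl ENNReal.ofReal_ne_top)] at hcheb
  refine (hcheb.trans (ENNReal.div_le_div_right hHint _)).trans (le_of_eq ?_)
  rw [← ENNReal.ofReal_div_of_pos (by positivity)]
  congr 1
  -- This scaling identity turns the L^1 bound divided by σ/2 into exactly A (B/σ)^q.
  have hexp : q * r / m + r = q := by
    have : q * r * (1 / r) = q * r * (1 / m + 1 / q) := by rw [hmqr]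
    field_simp at this ⊢
    linarith
  have hR : (A ^ (1 / q) * B / σ) ^ q = A * β ^ q := by
    rw [mul_div_assoc, Real.mul_rpow (by positivity) (by positivity), ← Real.rpow_mul hApos.le,
      one_div_mul_cancel hq.ne', Real.rpow_one]
  have hℓr : ℓ ^ r = (4 * κ) ^ (q * r / m) * β ^ (q * r / m) := by
    rw [hℓ, ← Real.rpow_mul (by positivity), Real.mul_rpow (by positivity) hβpos.le,
      div_mul_eq_mul_div]
  have hβq : β ^ q = β ^ (q * r / m) * β ^ r := by rw [← Real.rpow_add hβpos, hexp]
  have haR : a ^ (1 - r) = (8 * c) ^ (r - 1) * ℓ ^ (r - 1) * σ ^ (1 - r) := by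
    rw [ha, Real.div_rpow hσ.le (by positivity), Real.mul_rpow (by positivity) hℓpos.le,
      show (1 - r) = -(r - 1) by ring, Real.rpow_neg (by positivity), Real.rpow_neg (by positivity),
      Real.rpow_neg (by positivity)]
    field_simp
  have hBβ : B ^ r = β ^ r * σ ^ r := by
    rw [← Real.mul_rpow hβpos.le hσ.le]; congr 1; rw [hβ]; field_simp
  have hℓ1 : ℓ * ℓ ^ (r - 1) = ℓ ^ r := by
    nth_rewrite 1 [← Real.rpow_one ℓ]; rw [← Real.rpow_add hℓpos]; congr 1; ring
  have hσ1 : σ ^ r * σ ^ (1 - r) = σ := by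
    rw [← Real.rpow_add hσ]; simp
  rw [hR, hβq, hL, haR, hBβ, div_eq_iff (by positivity), hA]
  calc _ = 2 * c * tailConst r * (8 * c) ^ (r - 1) * β ^ r * (ℓ * ℓ ^ (r - 1)) *
        (σ ^ r * σ ^ (1 - r)) := by ring
    _ = _ := by rw [hℓ1, hσ1, hℓr]; ring

end potential

/-! ### Contraction for the linearized boundary inequality. -/

section contraction

variable {E : Type*} [MeasurableSpace E] {μ : Measure E} {m c q r : ℝ}
  {K : ℝ → E → E → ℝ≥0∞}

/-- The heat potential with density `f` on the boundary. -/
noncomputable def heatPotential (μ : Measure E) (K : ℝ → E → E → ℝ≥0∞) (f : ℝ → E → ℝ) (t : ℝ)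
    (x : E) : ℝ≥0∞ :=
  ∫⁻ s in Ioo 0 t, ∫⁻ y, K (t - s) x y * ‖f s y‖ₑ ∂μ

theorem heatPotential_mono {f g : ℝ → E → ℝ} (h : ∀ s, 0 < s → ∀ᵐ y ∂μ, ‖f s y‖ₑ ≤ ‖g s y‖ₑ)
    (t : ℝ) (x : E) : heatPotential μ K f t x ≤ heatPotential μ K g t x := by
  refine setLIntegral_mono' measurableSet_Ioo fun s hs => lintegral_mono_ae ?_
  filter_upwards [h s hs.1] with y hy
  gcongr

/-- The heat potential maps curves bounded by `B` in weak `L^r` to curves bounded by `C * B` in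
weak `L^q`. -/
def HeatPotentialBound (μ : Measure E) (K : ℝ → E → E → ℝ≥0∞) (q r C : ℝ) : Prop :=
  ∀ (B : ℝ) (f : ℝ → E → ℝ), 0 < B →
    AEStronglyMeasurable (fun z : ℝ × E => f z.1 z.2) ((volume.restrict (Ioi 0)).prod μ) →
    (∀ s, 0 < s → WeakBound r B μ (fun y => ‖f s y‖ₑ)) →
    ∀ t, WeakBound q (C * B) μ (heatPotential μ K f t)

/-- Passing to a measurable representative changes almost every time slice only on a null set, so
the potential is unaffected. -/
theorem IsHeatLike.exists_heatPotentialBound [SFinite μ] (hK : IsHeatLike μ m c K) (hm : 0 < m) (hc : 0 < c)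
    (hq : 0 < q) (hr : 1 < r) (hmqr : 1 / r = 1 / m + 1 / q) :
    ∃ C : ℝ, 0 < C ∧ HeatPotentialBound μ K q r C := by
  obtain ⟨C, hC, hCb⟩ := hK.exists_weakBound_potential hm hc hq hr hmqr
  refine ⟨C, hC, fun B f hB hf h t => ?_⟩
  have hae : ∀ᵐ s ∂volume.restrict (Ioo 0 t), ∀ᵐ y ∂μ, f s y = hf.mk _ (s, y) :=
    ae_restrict_of_ae_restrict_of_subset Ioo_subset_Ioi_self
      (Measure.ae_ae_of_ae_prod hf.ae_eq_mk)
  have h1 := hCb B t (hf.mk _) hB hf.stronglyMeasurable_mk.measurable (by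
    filter_upwards [hae, ae_restrict_mem measurableSet_Ioo] with s hs hst
    refine (h s hst.1).mono (by linarith) hB.le le_rfl ?_
    filter_upwards [hs] with y hy
    rw [hy])
  refine h1.mono hq.le (by positivity) le_rfl (ae_of_all _ fun x => lintegral_mono_ae ?_)
  filter_upwards [hae] with s hs
  refine lintegral_mono_ae ?_
  filter_upwards [hs] with y hy
  rw [hy]

/-- A curve in weak `L^q` that is dominated by the heat potential of its product with a small
coefficient vanishes. -/
theorem HeatPotentialBound.ae_eq_zero {C κ A : ℝ} (h : HeatPotentialBound μ K q r C)
    (hm : 0 < m) (hq : 0 < q) (hr : 1 < r) (hmqr : 1 / r = 1 / m + 1 / q)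
    (hC : 0 < C) (hκ : 0 < κ) (hCκ : 2 * C * κ < 1) (hA : 0 < A) {D M : ℝ → E → ℝ}
    (hDm : AEStronglyMeasurable (fun z : ℝ × E => D z.1 z.2) ((volume.restrict (Ioi 0)).prod μ))
    (hMm : AEStronglyMeasurable (fun z : ℝ × E => M z.1 z.2) ((volume.restrict (Ioi 0)).prod μ))
    (hD : ∀ t, 0 < t → WeakBound q A μ (fun y => ‖D t y‖ₑ))
    (hM : ∀ t, 0 < t → WeakBound m κ μ (fun y => ‖M t y‖ₑ))
    (hle : ∀ t, 0 < t → ∀ᵐ x ∂μ, ‖D t x‖ₑ ≤ heatPotential μ K (fun s y => M s y * D s y) t x) :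
    ∀ t, 0 < t → ∀ᵐ x ∂μ, D t x = 0 := by
  have hθ : 0 < 2 * C * κ := by positivity
  have key : ∀ k : ℕ, ∀ t, 0 < t → WeakBound q ((2 * C * κ) ^ k * A) μ (fun y => ‖D t y‖ₑ) := by
    intro k
    induction k with
    | zero => simpa using hD
    | succ k ih =>
      intro t ht
      -- Hölder's inequality costs κ and a factor 2, the potential costs C: each round multiplies
      -- the bound by 2Cκ.
      have h1 := h (2 * (κ * ((2 * C * κ) ^ k * A))) (fun s y => M s y * D s y) (by positivity)
        (hMm.mul hDm) (fun s hs => by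
          simpa only [enorm_mul] using
            (hM s hs).mul hm hq hr.le hmqr hκ (by positivity) (ih s hs)) t
      refine h1.mono hq.le (by positivity) (le_of_eq ?_) (hle t ht)
      rw [pow_succ]; ring
  intro t ht
  have := ae_eq_zero_of_weakBound hq hθ.le hCκ fun k => key k t ht
  filter_upwards [this] with x hx
  simpa using hx

end contraction

/-! ### The Neumann heat kernel of the half-space. -/

section heatKernel

variable {n : ℕ}

theorem measurable_heatKernel :
    Measurable fun z : ℝ × Space n × Space n => heatKernel z.2.1 z.2.2 z.1 := by
  unfold heatKernel
  fun_prop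

theorem heatKernel_nonneg (x y : Space n) {t : ℝ} (ht : 0 ≤ t) : 0 ≤ heatKernel x y t := by
  unfold heatKernel
  have := Real.pi_pos
  positivity

theorem heatKernel_pos (x y : Space n) {t : ℝ} (ht : 0 < t) : 0 < heatKernel x y t := by
  unfold heatKernel
  have := Real.pi_pos
  positivity

theorem heatKernel_le (x y : Space n) {t : ℝ} (ht : 0 < t) :
    heatKernel x y t ≤ 2 * (4 * Real.pi * t) ^ (-(n : ℝ) / 2) := by
  unfold heatKernel
  have := Real.pi_pos
  have h1 : Real.exp (-(‖x.1 - y.1‖ ^ 2 + (x.2 - y.2) ^ 2) / (4 * t)) ≤ 1 := by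
    rw [Real.exp_le_one_iff]
    exact div_nonpos_of_nonpos_of_nonneg (by nlinarith [sq_nonneg ‖x.1 - y.1‖, sq_nonneg (x.2 - y.2)])
      (by positivity)
  have h2 : Real.exp (-(‖x.1 - y.1‖ ^ 2 + (x.2 + y.2) ^ 2) / (4 * t)) ≤ 1 := by
    rw [Real.exp_le_one_iff]
    exact div_nonpos_of_nonpos_of_nonneg (by nlinarith [sq_nonneg ‖x.1 - y.1‖, sq_nonneg (x.2 + y.2)])
      (by positivity)
  rw [mul_comm 2]
  gcongr
  linarith

theorem integrable_exp_neg_sq_norm_sub (x : Bdry n) {t : ℝ} (ht : 0 < t) :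
    Integrable fun y : Bdry n => Real.exp (-(‖x - y‖ ^ 2) / (4 * t)) := by
  have h : Integrable fun y : Bdry n => Real.exp (-(1 / (4 * t)) * ‖y‖ ^ 2) := by
    have := (GaussianFourier.integrable_cexp_neg_mul_sq_norm_add (V := Bdry n)
      (b := ((1 / (4 * t) : ℝ) : ℂ)) (by rw [Complex.ofReal_re]; positivity) 0 0).norm
    refine this.congr (ae_of_all _ fun y => ?_)
    simp only [Complex.norm_exp]
    congr 1
    simp [← Complex.ofReal_pow]
  refine (h.comp_sub_left x).congr (ae_of_all _ fun y => ?_)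
  simp only
  congr 1
  ring

theorem integral_exp_neg_sq_norm_sub (hn : 1 ≤ n) (x : Bdry n) {t : ℝ} (ht : 0 < t) :
    ∫ y : Bdry n, Real.exp (-(‖x - y‖ ^ 2) / (4 * t)) =
      (4 * Real.pi * t) ^ (((n : ℝ) - 1) / 2) := by
  have h := GaussianFourier.integral_rexp_neg_mul_sq_norm (V := Bdry n) (b := 1 / (4 * t))
    (by positivity)
  rw [← integral_sub_left_eq_self _ volume x] at h
  have hfr : (Module.finrank ℝ (Bdry n) : ℝ) = (n : ℝ) - 1 := by
    rw [finrank_euclideanSpace_fin, Nat.cast_sub hn, Nat.cast_one]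
  rw [hfr] at h
  convert h using 2
  · ext y; congr 1; ring
  · field_simp

/-- The heat kernel between points of the boundary. -/
noncomputable def bdryKernel (τ : ℝ) (x y : Bdry n) : ℝ≥0∞ :=
  ENNReal.ofReal (heatKernel (x, 0) (y, 0) τ)

/-- On the boundary the two Gaussians coincide, whence the factor 2. The normalization is
n-dimensional but the integral is (n-1)-dimensional, which leaves τ^(-1/2). -/
theorem lintegral_bdryKernel_le (hn : 1 ≤ n) (x : Bdry n) {τ : ℝ} (hτ : 0 < τ) :
    ∫⁻ y, bdryKernel τ x y ≤ ENNReal.ofReal (2 * τ ^ (-(1 / 2) : ℝ)) := by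
  have hpi := Real.pi_gt_three
  have hpos : 0 < 4 * Real.pi * τ := by positivity
  have heq : ∀ y : Bdry n, heatKernel (x, 0) (y, 0) τ =
      2 * (4 * Real.pi * τ) ^ (-(n : ℝ) / 2) * Real.exp (-(‖x - y‖ ^ 2) / (4 * τ)) := by
    intro y
    simp only [heatKernel, sub_zero, add_zero]
    norm_num
    ring
  unfold bdryKernel
  simp_rw [heq]
  rw [← ofReal_integral_eq_lintegral_ofReal
    ((integrable_exp_neg_sq_norm_sub x hτ).const_mul _) (ae_of_all _ fun y => by
      simp only [Pi.zero_apply]; positivity),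
    integral_const_mul, integral_exp_neg_sq_norm_sub hn x hτ, mul_assoc, ← Real.rpow_add hpos,
    show -(n : ℝ) / 2 + ((n : ℝ) - 1) / 2 = -(1 / 2) by ring]
  refine ENNReal.ofReal_le_ofReal ?_
  refine mul_le_mul_of_nonneg_left ?_ (by norm_num)
  exact Real.rpow_le_rpow_of_nonpos hτ (by nlinarith) (by norm_num)

theorem bdryKernel_comm (τ : ℝ) (x y : Bdry n) : bdryKernel τ x y = bdryKernel τ y x := by
  simp only [bdryKernel, heatKernel, norm_sub_rev x y]

theorem isHeatLike_bdryKernel (hn : 1 ≤ n) :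
    IsHeatLike (volume : Measure (Bdry n)) ((n : ℝ) - 1) 2 bdryKernel where
  measurable := by
    refine ENNReal.measurable_ofReal.comp ?_
    exact measurable_heatKernel.comp (f := fun z : ℝ × Bdry n × Bdry n =>
      (z.1, ((z.2.1, (0 : ℝ)) : Space n), ((z.2.2, (0 : ℝ)) : Space n))) (by fun_prop)
  lintegral_right_le τ hτ x := lintegral_bdryKernel_le hn x hτ
  lintegral_left_le τ hτ y := by
    simp_rw [bdryKernel_comm τ _ y]
    exact lintegral_bdryKernel_le hn y hτ
  le τ hτ x y := by
    have hpi := Real.pi_gt_three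
    refine ENNReal.ofReal_le_ofReal ((heatKernel_le _ _ hτ).trans ?_)
    refine mul_le_mul_of_nonneg_left ?_ (by norm_num)
    rw [show -(n : ℝ) / 2 = -(((n : ℝ) - 1 + 1) / 2) by ring]
    exact Real.rpow_le_rpow_of_nonpos hτ (by nlinarith) (by
      have : (0 : ℝ) ≤ n := by positivity
      linarith)

theorem integrable_heatKernel (x : Space n) {t : ℝ} (ht : 0 < t) :
    Integrable fun y : Space n => heatKernel x y t := by
  have hone : Integrable fun s : ℝ => Real.exp (-(1 / (4 * t)) * s ^ 2) :=
    integrable_exp_neg_mul_sq (by positivity)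
  have h1 := (integrable_exp_neg_sq_norm_sub x.1 ht).mul_prod (hone.comp_sub_left x.2)
  have h2 := (integrable_exp_neg_sq_norm_sub x.1 ht).mul_prod (hone.comp_add_left x.2)
  refine ((h1.add h2).const_mul ((4 * Real.pi * t) ^ (-(n : ℝ) / 2))).congr
    (ae_of_all _ fun y => ?_)
  simp only [heatKernel, Pi.add_apply, ← Real.exp_add]
  congr 3 <;> ring

/-- Cut u₀ at level 1: the kernel is integrable against the bounded part, and it is bounded against
the tail, which is integrable as p > 1. -/
theorem integrable_heatKernel_mul {p : ℝ} (hp : 1 < p) {u₀ : Space n → ℝ}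
    (hu : MemWeak p (volHalf n) u₀) (x : Space n) {t : ℝ} (ht : 0 < t) :
    Integrable (fun y => heatKernel x y t * u₀ y) (volHalf n) := by
  have hGm : Measurable fun y : Space n => heatKernel x y t :=
    measurable_heatKernel.comp (measurable_const.prodMk (measurable_const.prodMk measurable_id))
  have hGi : Integrable (fun y : Space n => heatKernel x y t) (volHalf n) :=
    (integrable_heatKernel x ht).restrict
  refine ⟨hGm.aestronglyMeasurable.mul hu.1, ?_⟩
  set N : ℝ := (weakNorm p (volHalf n) u₀).toReal + 1 with hN
  have hNpos : 0 < N := by positivity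
  have hw : WeakBound p N (volHalf n) (fun y => ‖u₀ y‖ₑ) :=
    weakBound_of_weakNorm_le (by linarith) hNpos.le (by
      rw [← ENNReal.ofReal_toReal hu.2.ne]
      exact ENNReal.ofReal_le_ofReal (by linarith))
  have htail := hw.lintegral_indicator_le hu.1.aemeasurable hp hNpos one_pos
  set S : ℝ≥0∞ := ENNReal.ofReal (2 * (4 * Real.pi * t) ^ (-(n : ℝ) / 2)) with hS
  have hle : ∀ y, ‖heatKernel x y t * u₀ y‖ₑ ≤ ‖heatKernel x y t‖ₑ +
      S * {y | ENNReal.ofReal 1 < ‖u₀ y‖ₑ}.indicator (fun y => ‖u₀ y‖ₑ) y := by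
    intro y
    have hG : ‖heatKernel x y t‖ₑ ≤ S := by
      rw [Real.enorm_eq_ofReal (heatKernel_nonneg x y ht.le)]
      exact ENNReal.ofReal_le_ofReal (heatKernel_le x y ht)
    rw [enorm_mul]
    refine (mul_le_mul_right (enorm_le_add_indicator u₀ 1 y) _).trans ?_
    rw [mul_add, ENNReal.ofReal_one, mul_one]
    gcongr
  rw [hasFiniteIntegral_iff_enorm]
  calc _ ≤ _ := lintegral_mono hle
    _ = (∫⁻ y, ‖heatKernel x y t‖ₑ ∂volHalf n) + _ := lintegral_add_left hGm.enorm _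
    _ < ∞ := by
        rw [lintegral_const_mul' _ _ ENNReal.ofReal_ne_top]
        exact ENNReal.add_lt_top.2 ⟨hGi.2, ENNReal.mul_lt_top ENNReal.ofReal_lt_top
          (htail.trans_lt ENNReal.ofReal_lt_top)⟩

theorem integral_heatKernel_mul_pos {p : ℝ} (hp : 1 < p) {u₀ : Space n → ℝ}
    (hu : MemWeak p (volHalf n) u₀) (hu0 : ∀ᵐ x ∂volHalf n, 0 ≤ u₀ x) {U : Set (Space n)}
    (hU : U ⊆ halfSpace n) (hUpos : 0 < volume U) (hUu : ∀ x ∈ U, 0 < u₀ x) (x : Space n) {t : ℝ}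
    (ht : 0 < t) : 0 < ∫ y, heatKernel x y t * u₀ y ∂volHalf n := by
  have hnn : 0 ≤ᵐ[volHalf n] fun y => heatKernel x y t * u₀ y := by
    filter_upwards [hu0] with y hy
    exact mul_nonneg (heatKernel_nonneg x y ht.le) hy
  rw [integral_pos_iff_support_of_nonneg_ae hnn (integrable_heatKernel_mul hp hu x ht)]
  have hm : MeasurableSet (halfSpace n) := measurableSet_lt measurable_const measurable_snd
  calc 0 < volume U := hUpos
    _ = volHalf n U := by rw [volHalf, Measure.restrict_apply' hm, inter_eq_self_of_subset_left hU]
    _ ≤ _ := measure_mono fun y hy =>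
        (mul_pos (heatKernel_pos x y ht) (hUu y hy)).ne'

end heatKernel

/-! ### Comparing Bochner integrals with the heat potential. -/

/-- Without integrability the Bochner integral is 0 and the bound is trivial, so the argument for
the negative part needs no integrability of the reaction. -/
theorem ofReal_neg_integral_le {α : Type*} [MeasurableSpace α] (μ : Measure α) (f : α → ℝ) :
    ENNReal.ofReal (-∫ x, f x ∂μ) ≤ ∫⁻ x, ENNReal.ofReal (-f x) ∂μ := by
  by_cases hf : Integrable f μ
  · rw [integral_eq_lintegral_pos_part_sub_lintegral_neg_part hf]
    refine (ENNReal.ofReal_le_ofReal ?_).trans ENNReal.ofReal_toReal_le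
    have : 0 ≤ (∫⁻ x, ENNReal.ofReal (f x) ∂μ).toReal := ENNReal.toReal_nonneg
    linarith
  · simp [integral_undef hf]

variable {n : ℕ}

theorem ofReal_neg_integral_heatKernel_le {f g : ℝ → Bdry n → ℝ}
    (h : ∀ s, 0 < s → ∀ᵐ y, -g s y ≤ ‖f s y‖) {t : ℝ} (ht : 0 < t) (x : Bdry n) :
    ENNReal.ofReal (-∫ s in (0 : ℝ)..t, ∫ y, heatKernel (x, 0) (y, 0) (t - s) * g s y) ≤
      heatPotential volume bdryKernel f t x := by
  rw [intervalIntegral.integral_of_le ht.le, ← restrict_Ioo_eq_restrict_Ioc]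
  refine (ofReal_neg_integral_le _ _).trans ?_
  refine setLIntegral_mono' measurableSet_Ioo fun s hs => ?_
  refine (ofReal_neg_integral_le _ _).trans ?_
  refine lintegral_mono_ae ?_
  filter_upwards [h s hs.1] with y hy
  have hG : 0 ≤ heatKernel ((x, 0) : Space n) (y, 0) (t - s) :=
    heatKernel_nonneg _ _ (by linarith [hs.2])
  rw [bdryKernel, ← ofReal_norm, ← ENNReal.ofReal_mul hG, ← mul_neg]
  gcongr

theorem integrable_heatKernel_mul_of_heatPotential_lt_top {g : ℝ → Bdry n → ℝ}
    (hg : AEStronglyMeasurable (fun z : ℝ × Bdry n => g z.1 z.2)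
      ((volume.restrict (Ioi 0)).prod volume)) {t : ℝ} {x : Bdry n}
    (hfin : heatPotential volume bdryKernel g t x < ∞) :
    Integrable (fun z : ℝ × Bdry n => heatKernel (x, 0) (z.2, 0) (t - z.1) * g z.1 z.2)
      ((volume.restrict (Ioo 0 t)).prod volume) := by
  have hGm : Measurable fun z : ℝ × Bdry n =>
      heatKernel ((x, 0) : Space n) (z.2, 0) (t - z.1) :=
    measurable_heatKernel.comp (f := fun z : ℝ × Bdry n =>
      (t - z.1, ((x, (0 : ℝ)) : Space n), ((z.2, (0 : ℝ)) : Space n))) (by fun_prop)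
  have hg' : AEStronglyMeasurable (fun z : ℝ × Bdry n => g z.1 z.2)
      ((volume.restrict (Ioo 0 t)).prod volume) :=
    hg.mono_measure (Measure.prod_mono (Measure.restrict_mono Ioo_subset_Ioi_self le_rfl) le_rfl)
  have hm : AEStronglyMeasurable
      (fun z : ℝ × Bdry n => heatKernel (x, 0) (z.2, 0) (t - z.1) * g z.1 z.2)
      ((volume.restrict (Ioo 0 t)).prod volume) := hGm.aestronglyMeasurable.mul hg'
  refine ⟨hm, ?_⟩
  rw [hasFiniteIntegral_iff_enorm, lintegral_prod _ hm.enorm]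
  refine lt_of_le_of_lt (setLIntegral_mono' measurableSet_Ioo fun s hs => ?_) hfin
  refine lintegral_mono fun y => ?_
  rw [enorm_mul, Real.enorm_eq_ofReal (heatKernel_nonneg _ _ (by linarith [hs.2])), bdryKernel]

/-- Finiteness of both potentials gives joint integrability, which allows the difference of the
iterated integrals to be taken under one product integral. -/
theorem enorm_integral_heatKernel_sub_le {g₁ g₂ : ℝ → Bdry n → ℝ}
    (hg₁ : AEStronglyMeasurable (fun z : ℝ × Bdry n => g₁ z.1 z.2)
      ((volume.restrict (Ioi 0)).prod volume))
    (hg₂ : AEStronglyMeasurable (fun z : ℝ × Bdry n => g₂ z.1 z.2)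
      ((volume.restrict (Ioi 0)).prod volume)) {t : ℝ} (ht : 0 < t) {x : Bdry n}
    (hfin₁ : heatPotential volume bdryKernel g₁ t x < ∞)
    (hfin₂ : heatPotential volume bdryKernel g₂ t x < ∞) :
    ‖(∫ s in (0 : ℝ)..t, ∫ y, heatKernel (x, 0) (y, 0) (t - s) * g₁ s y) -
      ∫ s in (0 : ℝ)..t, ∫ y, heatKernel (x, 0) (y, 0) (t - s) * g₂ s y‖ₑ ≤
      heatPotential volume bdryKernel (fun s y => g₁ s y - g₂ s y) t x := by
  have h1 := integrable_heatKernel_mul_of_heatPotential_lt_top hg₁ hfin₁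
  have h2 := integrable_heatKernel_mul_of_heatPotential_lt_top hg₂ hfin₂
  simp only [intervalIntegral.integral_of_le ht.le, ← restrict_Ioo_eq_restrict_Ioc]
  rw [← integral_prod _ h1, ← integral_prod _ h2, ← integral_sub h1 h2]
  refine (enorm_integral_le_lintegral_enorm _).trans ?_
  have hm : AEStronglyMeasurable (fun z : ℝ × Bdry n =>
      heatKernel (x, 0) (z.2, 0) (t - z.1) * g₁ z.1 z.2 -
        heatKernel (x, 0) (z.2, 0) (t - z.1) * g₂ z.1 z.2)
      ((volume.restrict (Ioo 0 t)).prod volume) := (h1.sub h2).1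
  rw [lintegral_prod _ hm.enorm]
  refine setLIntegral_mono' measurableSet_Ioo fun s hs => lintegral_mono fun y => ?_
  rw [← mul_sub, enorm_mul, Real.enorm_eq_ofReal (heatKernel_nonneg _ _ (by linarith [hs.2])),
    bdryKernel]

/-! ### Lipschitz coefficient of the boundary reaction. -/

section nonlinearity

variable {η ρ : ℝ} {h : ℝ → ℝ}

theorem continuous_of_abs_sub_le (hρ : 1 < ρ)
    (hh : ∀ a b : ℝ, |h a - h b| ≤ η * |a - b| * (|a| ^ (ρ - 1) + |b| ^ (ρ - 1))) :
    Continuous h := by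
  rw [continuous_iff_continuousAt]
  intro b
  rw [ContinuousAt, tendsto_iff_dist_tendsto_zero]
  refine squeeze_zero (fun _ => dist_nonneg) (fun a => (Real.dist_eq _ _).trans_le (hh a b)) ?_
  have hc : Continuous fun a : ℝ => η * |a - b| * (|a| ^ (ρ - 1) + |b| ^ (ρ - 1)) := by
    have : Continuous fun a : ℝ => |a| ^ (ρ - 1) :=
      continuous_abs.rpow_const fun _ => Or.inr (by linarith)
    fun_prop
  simpa using hc.tendsto b

/-- The coefficient that bounds the Lipschitz constant of `w ↦ h w + V w` between `w₁` and `w₂`. -/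
noncomputable def lipCoeff (η ρ : ℝ) (V : Bdry n → ℝ) (w₁ w₂ : ℝ → Bdry n → ℝ) (s : ℝ)
    (y : Bdry n) : ℝ :=
  |V y| + max η 0 * (|w₁ s y| ^ (ρ - 1) + |w₂ s y| ^ (ρ - 1))

variable {V : Bdry n → ℝ} {w₁ w₂ : ℝ → Bdry n → ℝ}

theorem lipCoeff_nonneg (s : ℝ) (y : Bdry n) : 0 ≤ lipCoeff η ρ V w₁ w₂ s y := by
  unfold lipCoeff
  have := le_max_right η 0
  positivity

theorem lipCoeff_comm (s : ℝ) (y : Bdry n) :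
    lipCoeff η ρ V w₁ w₂ s y = lipCoeff η ρ V w₂ w₁ s y := by
  simp only [lipCoeff, add_comm]

theorem abs_reaction_sub_le
    (hh : ∀ a b : ℝ, |h a - h b| ≤ η * |a - b| * (|a| ^ (ρ - 1) + |b| ^ (ρ - 1)))
    (s : ℝ) (y : Bdry n) :
    |h (w₁ s y) + V y * w₁ s y - (h (w₂ s y) + V y * w₂ s y)| ≤
      lipCoeff η ρ V w₁ w₂ s y * |w₁ s y - w₂ s y| := by
  set a := w₁ s y
  set b := w₂ s y
  have h1 : |h a - h b| ≤ max η 0 * |a - b| * (|a| ^ (ρ - 1) + |b| ^ (ρ - 1)) :=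
    (hh a b).trans (by gcongr; exact le_max_left _ _)
  calc _ = |(h a - h b) + V y * (a - b)| := by congr 1; ring
    _ ≤ |h a - h b| + |V y * (a - b)| := abs_add_le _ _
    _ ≤ max η 0 * |a - b| * (|a| ^ (ρ - 1) + |b| ^ (ρ - 1)) + |V y| * |a - b| := by
        rw [abs_mul]; gcongr
    _ = _ := by unfold lipCoeff; ring

/-- Comparison with the zero curve, since h(0) = 0. The second curve only enlarges the coefficient,
so one coefficient serves both solutions in the uniqueness proof. -/
theorem abs_reaction_le (hρ : 1 < ρ) (h0 : h 0 = 0)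
    (hh : ∀ a b : ℝ, |h a - h b| ≤ η * |a - b| * (|a| ^ (ρ - 1) + |b| ^ (ρ - 1)))
    (s : ℝ) (y : Bdry n) :
    |h (w₁ s y) + V y * w₁ s y| ≤ lipCoeff η ρ V w₁ w₂ s y * |w₁ s y| := by
  have h1 := abs_reaction_sub_le (V := V) (w₁ := w₁) (w₂ := fun _ _ => 0) hh s y
  simp only [h0, mul_zero, add_zero, sub_zero] at h1
  refine h1.trans ?_
  refine mul_le_mul_of_nonneg_right ?_ (abs_nonneg _)
  unfold lipCoeff
  rw [abs_zero, Real.zero_rpow (by linarith)]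
  have := le_max_right η 0
  gcongr
  positivity

theorem aestronglyMeasurable_lipCoeff (hρ : 1 < ρ) (hV : AEStronglyMeasurable V)
    (hw₁ : AEStronglyMeasurable (fun z : ℝ × Bdry n => w₁ z.1 z.2)
      ((volume.restrict (Ioi 0)).prod volume))
    (hw₂ : AEStronglyMeasurable (fun z : ℝ × Bdry n => w₂ z.1 z.2)
      ((volume.restrict (Ioi 0)).prod volume)) :
    AEStronglyMeasurable (fun z : ℝ × Bdry n => lipCoeff η ρ V w₁ w₂ z.1 z.2)
      ((volume.restrict (Ioi 0)).prod volume) := by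
  have hc : Continuous fun a : ℝ => |a| ^ (ρ - 1) :=
    continuous_abs.rpow_const fun _ => Or.inr (by linarith)
  have hV' : AEStronglyMeasurable (fun z : ℝ × Bdry n => V z.2)
      ((volume.restrict (Ioi 0)).prod volume) := hV.comp_snd
  exact (continuous_abs.comp_aestronglyMeasurable hV').add
    (((hc.comp_aestronglyMeasurable hw₁).add (hc.comp_aestronglyMeasurable hw₂)).const_mul _)

theorem aestronglyMeasurable_reaction (hρ : 1 < ρ)
    (hh : ∀ a b : ℝ, |h a - h b| ≤ η * |a - b| * (|a| ^ (ρ - 1) + |b| ^ (ρ - 1)))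
    (hV : AEStronglyMeasurable V)
    (hw₁ : AEStronglyMeasurable (fun z : ℝ × Bdry n => w₁ z.1 z.2)
      ((volume.restrict (Ioi 0)).prod volume)) :
    AEStronglyMeasurable (fun z : ℝ × Bdry n => h (w₁ z.1 z.2) + V z.2 * w₁ z.1 z.2)
      ((volume.restrict (Ioi 0)).prod volume) := by
  have hV' : AEStronglyMeasurable (fun z : ℝ × Bdry n => V z.2)
      ((volume.restrict (Ioi 0)).prod volume) := hV.comp_snd
  exact ((continuous_of_abs_sub_le hρ hh).comp_aestronglyMeasurable hw₁).add (hV'.mul hw₁)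

/-- The relation q = m(ρ-1) puts |w|^(ρ-1) in the same weak L^m as V. The factors 2 and 4 come from
the quasi-triangle inequality applied twice. -/
theorem weakBound_lipCoeff {m q v N κ : ℝ} (hρ : 1 < ρ) (hm : 1 ≤ m) (hq : q = m * (ρ - 1))
    (hv : 0 ≤ v) (hN : 0 ≤ N) (hV : WeakBound m v volume (fun y => ‖V y‖ₑ)) {s : ℝ}
    (hw₁ : WeakBound q N volume (fun y => ‖w₁ s y‖ₑ))
    (hw₂ : WeakBound q N volume (fun y => ‖w₂ s y‖ₑ))
    (hκ : 2 * (v + max η 0 * (4 * N ^ (ρ - 1))) ≤ κ) :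
    WeakBound m κ volume (fun y => ‖lipCoeff η ρ V w₁ w₂ s y‖ₑ) := by
  have hρ' : 0 < ρ - 1 := by linarith
  have hη := le_max_right η 0
  have hqm : q / (ρ - 1) = m := by rw [hq]; field_simp
  have h1 := hw₁.rpow hρ' hN
  have h2 := hw₂.rpow hρ' hN
  rw [hqm] at h1 h2
  have h3 := WeakBound.add hm hv (by positivity) hV
    ((WeakBound.add hm (by positivity) (by positivity) h1 h2).const_mul hη)
  refine h3.mono (by linarith) (by positivity) (le_trans (le_of_eq (by ring)) hκ)
    (ae_of_all _ fun y => le_of_eq ?_)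
  have e1 : (0 : ℝ) ≤ |w₁ s y| ^ (ρ - 1) := by positivity
  have e2 : (0 : ℝ) ≤ |w₂ s y| ^ (ρ - 1) := by positivity
  rw [Real.enorm_eq_ofReal (lipCoeff_nonneg s y), lipCoeff,
    ENNReal.ofReal_add (abs_nonneg _) (by positivity), ENNReal.ofReal_mul hη,
    ENNReal.ofReal_add e1 e2, Real.enorm_eq_ofReal_abs (V y), Real.enorm_eq_ofReal e1,
    Real.enorm_eq_ofReal e2]

end nonlinearity

/-! ### Uniqueness and sign of the trace. -/

section boundary

variable {η ρ C κ v N : ℝ} {m q r : ℝ} {h : ℝ → ℝ} {V : Bdry n → ℝ} {F : ℝ → Bdry n → ℝ}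

/-- The numerical conditions under which the boundary integral equation is a contraction on curves
bounded by `N` in weak `L^q`, for coefficients `V` bounded by `v` in weak `L^m`. -/
structure SmallnessRegime (n : ℕ) (η ρ m q r C κ v N : ℝ) : Prop where
  potential : HeatPotentialBound (volume : Measure (Bdry n)) bdryKernel q r C
  one_lt_rho : 1 < ρ
  one_le_m : 1 ≤ m
  q_eq : q = m * (ρ - 1)
  one_le_q : 1 ≤ q
  one_lt_r : 1 < r
  inv_r : 1 / r = 1 / m + 1 / q
  C_pos : 0 < C
  κ_pos : 0 < κ
  contraction : 2 * C * κ < 1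
  v_nonneg : 0 ≤ v
  N_pos : 0 < N
  coeff_le : 2 * (v + max η 0 * (4 * N ^ (ρ - 1))) ≤ κ

/-- Uniqueness of small boundary values of mild solutions. -/
theorem SmallnessRegime.bdry_unique
    (hS : SmallnessRegime n η ρ m q r C κ v N) (h0 : h 0 = 0)
    (hh : ∀ a b : ℝ, |h a - h b| ≤ η * |a - b| * (|a| ^ (ρ - 1) + |b| ^ (ρ - 1)))
    (hVm : AEStronglyMeasurable V) (hV : WeakBound m v volume (fun y => ‖V y‖ₑ))
    {w₁ w₂ : ℝ → Bdry n → ℝ}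
    (hm₁ : AEStronglyMeasurable (fun z : ℝ × Bdry n => w₁ z.1 z.2)
      ((volume.restrict (Ioi 0)).prod volume))
    (hm₂ : AEStronglyMeasurable (fun z : ℝ × Bdry n => w₂ z.1 z.2)
      ((volume.restrict (Ioi 0)).prod volume))
    (hw₁ : ∀ s, 0 < s → WeakBound q N volume (fun y => ‖w₁ s y‖ₑ))
    (hw₂ : ∀ s, 0 < s → WeakBound q N volume (fun y => ‖w₂ s y‖ₑ))
    (he₁ : ∀ t, 0 < t → ∀ᵐ x, w₁ t x = F t x + ∫ s in (0 : ℝ)..t, ∫ y,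
      heatKernel (x, 0) (y, 0) (t - s) * (h (w₁ s y) + V y * w₁ s y))
    (he₂ : ∀ t, 0 < t → ∀ᵐ x, w₂ t x = F t x + ∫ s in (0 : ℝ)..t, ∫ y,
      heatKernel (x, 0) (y, 0) (t - s) * (h (w₂ s y) + V y * w₂ s y)) :
    ∀ t, 0 < t → ∀ᵐ x, w₁ t x = w₂ t x := by
  obtain ⟨hC, hρ, hm, hq, hq1, hr, hmqr, hCpos, hκ, hCκ, hv, hN, hκv⟩ := hS
  have hq0 : 0 < q := by linarith
  have hm0 : 0 < m := by linarith
  have hM : ∀ s, 0 < s → WeakBound m κ volume (fun y => ‖lipCoeff η ρ V w₁ w₂ s y‖ₑ) :=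
    fun s hs => weakBound_lipCoeff hρ hm hq hv hN.le hV (hw₁ s hs) (hw₂ s hs) hκv
  have hMm := aestronglyMeasurable_lipCoeff (η := η) hρ hVm hm₁ hm₂
  have hgm₁ := aestronglyMeasurable_reaction hρ hh hVm hm₁
  have hgm₂ := aestronglyMeasurable_reaction hρ hh hVm hm₂
  -- The integrals can be subtracted only where both potentials are finite; the weak L^q bound gives
  -- this almost everywhere.
  have hfin : ∀ w : ℝ → Bdry n → ℝ, (∀ s, 0 < s → WeakBound q N volume (fun y => ‖w s y‖ₑ)) →
      AEStronglyMeasurable (fun z : ℝ × Bdry n => h (w z.1 z.2) + V z.2 * w z.1 z.2)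
        ((volume.restrict (Ioi 0)).prod volume) →
      (∀ s y, |h (w s y) + V y * w s y| ≤ lipCoeff η ρ V w₁ w₂ s y * |w s y|) →
      ∀ t, ∀ᵐ x, heatPotential volume bdryKernel (fun s y => h (w s y) + V y * w s y) t x < ∞ := by
    intro w hw hwm hle t
    refine (hC (2 * (κ * N)) _ (by positivity) hwm (fun s hs => ?_) t).ae_lt_top hq0
    refine ((hM s hs).mul hm0 hq0 hr.le hmqr hκ hN (hw s hs)).mono (by linarith) (by positivity)
      le_rfl (ae_of_all _ fun y => ?_)
    rw [← enorm_mul, Real.enorm_eq_ofReal_abs, Real.enorm_eq_ofReal_abs, abs_mul,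
      abs_of_nonneg (lipCoeff_nonneg s y)]
    exact ENNReal.ofReal_le_ofReal (hle s y)
  have hfin₁ := hfin w₁ hw₁ hgm₁ fun s y => abs_reaction_le hρ h0 hh s y
  have hfin₂ := hfin w₂ hw₂ hgm₂ fun s y => by
    rw [lipCoeff_comm]; exact abs_reaction_le hρ h0 hh s y
  have hz := hC.ae_eq_zero (A := 2 * (N + N)) (D := fun t y => w₁ t y - w₂ t y) hm0 hq0 hr hmqr
    hCpos hκ hCκ (by positivity) (hm₁.sub hm₂) hMm (fun t ht => by
      refine (WeakBound.add hq1 hN.le hN.le (hw₁ t ht) (hw₂ t ht)).mono hq0.le (by positivity)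
        le_rfl (ae_of_all _ fun y => enorm_sub_le)) hM (fun t ht => by
      filter_upwards [he₁ t ht, he₂ t ht, hfin₁ t, hfin₂ t] with x h1 h2 f1 f2
      rw [h1, h2, add_sub_add_left_eq_sub]
      refine (enorm_integral_heatKernel_sub_le hgm₁ hgm₂ ht f1 f2).trans ?_
      refine heatPotential_mono (fun s _ => ae_of_all _ fun y => ?_) t x
      rw [Real.enorm_eq_ofReal_abs, Real.enorm_eq_ofReal_abs, abs_mul,
        abs_of_nonneg (lipCoeff_nonneg s y)]
      exact ENNReal.ofReal_le_ofReal (abs_reaction_sub_le hh s y))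
  intro t ht
  filter_upwards [hz t ht] with x hx
  linarith

/-- Small boundary values of mild solutions with nonnegative data are nonnegative. -/
theorem SmallnessRegime.bdry_nonneg
    (hS : SmallnessRegime n η ρ m q r C κ v N) (h0 : h 0 = 0)
    (hh : ∀ a b : ℝ, |h a - h b| ≤ η * |a - b| * (|a| ^ (ρ - 1) + |b| ^ (ρ - 1)))
    (hVm : AEStronglyMeasurable V) (hV : WeakBound m v volume (fun y => ‖V y‖ₑ))
    (hpos : ∀ a, 0 ≤ a → 0 ≤ h a) (hVpos : ∀ᵐ y, 0 ≤ V y)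
    (hF : ∀ t, 0 < t → ∀ᵐ x, 0 ≤ F t x) {w : ℝ → Bdry n → ℝ}
    (hwm : AEStronglyMeasurable (fun z : ℝ × Bdry n => w z.1 z.2)
      ((volume.restrict (Ioi 0)).prod volume))
    (hw : ∀ s, 0 < s → WeakBound q N volume (fun y => ‖w s y‖ₑ))
    (he : ∀ t, 0 < t → ∀ᵐ x, w t x = F t x + ∫ s in (0 : ℝ)..t, ∫ y,
      heatKernel (x, 0) (y, 0) (t - s) * (h (w s y) + V y * w s y)) :
    ∀ t, 0 < t → ∀ᵐ x, 0 ≤ w t x := by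
  obtain ⟨hC, hρ, hm, hq, hq1, hr, hmqr, hCpos, hκ, hCκ, hv, hN, hκv⟩ := hS
  have hq0 : 0 < q := by linarith
  have hm0 : 0 < m := by linarith
  have hcont : Continuous fun a : ℝ => max (-a) 0 := by fun_prop
  -- The contraction is applied to the negative part: the term F ≥ 0 only helps, so only the
  -- negative part of the reaction has to be dominated.
  have hz := hC.ae_eq_zero (A := N) (D := fun t y => max (-w t y) 0)
    (M := lipCoeff η ρ V w w) hm0 hq0 hr hmqr
    hCpos hκ hCκ hN (hcont.comp_aestronglyMeasurable hwm)
    (aestronglyMeasurable_lipCoeff hρ hVm hwm hwm) (fun t ht => by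
      refine (hw t ht).mono hq0.le hN.le le_rfl (ae_of_all _ fun y => ?_)
      rw [Real.enorm_eq_ofReal_abs, Real.enorm_eq_ofReal_abs]
      refine ENNReal.ofReal_le_ofReal ?_
      rw [abs_of_nonneg (le_max_right _ _)]
      exact max_le (neg_le_abs _) (abs_nonneg _))
    (fun s hs => weakBound_lipCoeff hρ hm hq hv hN.le hV (hw s hs) (hw s hs) hκv)
    (fun t ht => by
      filter_upwards [he t ht, hF t ht] with x h1 h2
      have hle : -w t x ≤ -∫ s in (0 : ℝ)..t, ∫ y,
          heatKernel (x, 0) (y, 0) (t - s) * (h (w s y) + V y * w s y) := by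
        rw [h1]; linarith
      rw [Real.enorm_eq_ofReal (le_max_right _ _), ENNReal.ofReal_max, ENNReal.ofReal_zero,
        max_eq_left (zero_le)]
      refine (ENNReal.ofReal_le_ofReal hle).trans ?_
      refine ofReal_neg_integral_heatKernel_le (fun s hs => ?_) ht x
      filter_upwards [hVpos] with y hy
      rcases le_total 0 (w s y) with hs0 | hs0
      · have := add_nonneg (hpos _ hs0) (mul_nonneg hy hs0)
        exact (neg_nonpos.2 this).trans (norm_nonneg _)
      · rw [max_eq_left (by linarith), norm_mul, norm_neg, Real.norm_eq_abs, Real.norm_eq_abs,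
          abs_of_nonneg (lipCoeff_nonneg s y)]
        exact (neg_le_abs _).trans (abs_reaction_le hρ h0 hh s y))
  intro t ht
  filter_upwards [hz t ht] with x hx
  have := le_max_left (-w t x) 0
  linarith

end boundary

/-! ### Positivity and negativity of solutions. -/

variable {η ρ C κ v N m q r : ℝ} {h : ℝ → ℝ} {V : Bdry n → ℝ} {u₀ : Space n → ℝ}
  {u : ℝ → Space n → ℝ}

theorem weakNorm_neg {α : Type*} [MeasurableSpace α] (p : ℝ) (μ : Measure α) (f : α → ℝ) :
    weakNorm p μ (fun x => -f x) = weakNorm p μ f := by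
  simp only [weakNorm, avgRearrangement, rearrangement, distribution, enorm_neg]

/-- Change of sign exchanges solutions for h with solutions for a ↦ -h(-a) and leaves V as it is,
which reduces negativity to positivity. -/
theorem mildMap_neg (h : ℝ → ℝ) (V : Bdry n → ℝ) (u₀ : Space n → ℝ) (u : ℝ → Space n → ℝ) (t : ℝ)
    (x : Space n) :
    mildMap (fun a => -h (-a)) V (fun y => -u₀ y) (fun s y => -u s y) t x =
      -mildMap h V u₀ u t x := by
  simp only [mildMap, trace, neg_neg, mul_neg, ← neg_add, integral_neg,
    intervalIntegral.integral_neg]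

/-- Mild solutions with nonnegative nonzero initial data are positive. -/
theorem SmallnessRegime.pos (hS : SmallnessRegime n η ρ m q r C κ v N) (h0 : h 0 = 0)
    (hh : ∀ a b : ℝ, |h a - h b| ≤ η * |a - b| * (|a| ^ (ρ - 1) + |b| ^ (ρ - 1)))
    (hVm : AEStronglyMeasurable V) (hV : WeakBound m v volume (fun y => ‖V y‖ₑ))
    {p : ℝ} (hp : 1 < p) (hu₀ : MemWeak p (volHalf n) u₀)
    (hum : AEStronglyMeasurable (fun z : ℝ × Bdry n => trace (u z.1) z.2)
      ((volume.restrict (Ioi 0)).prod volume))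
    (hu : ∀ s, 0 < s → WeakBound q N volume (fun y => ‖trace (u s) y‖ₑ))
    (hint : ∀ t, 0 < t → ∀ᵐ x ∂(volHalf n), u t x = mildMap h V u₀ u t x)
    (hbdry : ∀ t, 0 < t → ∀ᵐ y' : Bdry n, u t (y', 0) = mildMap h V u₀ u t (y', 0))
    (hpos : ∀ a, 0 ≤ a → 0 ≤ h a) (hVpos : ∀ᵐ y, 0 ≤ V y)
    (hu₀pos : ∀ᵐ x ∂(volHalf n), 0 ≤ u₀ x)
    (hU : ∃ U : Set (Space n), U ⊆ halfSpace n ∧ 0 < volume U ∧ ∀ x ∈ U, 0 < u₀ x) :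
    (∀ t, 0 < t → ∀ᵐ x ∂(volHalf n), 0 < u t x) ∧
      (∀ t, 0 < t → ∀ x ∈ halfSpace n, 0 < mildMap h V u₀ u t x) := by
  obtain ⟨U, hU, hUpos, hUu⟩ := hU
  have hF : ∀ t, 0 < t → ∀ x, 0 < ∫ y, heatKernel x y t * u₀ y ∂(volHalf n) :=
    fun t ht x => integral_heatKernel_mul_pos hp hu₀ hu₀pos hU hUpos hUu x ht
  have htr := hS.bdry_nonneg (w := fun t y => trace (u t) y)
    (F := fun t x => ∫ y, heatKernel (x, 0) y t * u₀ y ∂(volHalf n)) h0 hh hVm hV hpos hVpos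
    (fun t ht => ae_of_all _ fun x => (hF t ht _).le) hum hu hbdry
  have hmild : ∀ t, 0 < t → ∀ x, 0 < mildMap h V u₀ u t x := by
    intro t ht x
    refine add_pos_of_pos_of_nonneg (hF t ht x) ?_
    rw [intervalIntegral.integral_of_le ht.le]
    refine setIntegral_nonneg measurableSet_Ioc fun s hs => integral_nonneg_of_ae ?_
    filter_upwards [htr s hs.1, hVpos] with y hy hVy
    exact mul_nonneg (heatKernel_nonneg _ _ (by linarith [hs.2]))
      (add_nonneg (hpos _ hy) (mul_nonneg hVy hy))
  refine ⟨fun t ht => ?_, fun t ht x _ => hmild t ht x⟩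
  filter_upwards [hint t ht] with x hx
  rw [hx]
  exact hmild t ht x

/-- Mild solutions with nonpositive nonzero initial data are negative. -/
theorem SmallnessRegime.neg (hS : SmallnessRegime n η ρ m q r C κ v N) (h0 : h 0 = 0)
    (hh : ∀ a b : ℝ, |h a - h b| ≤ η * |a - b| * (|a| ^ (ρ - 1) + |b| ^ (ρ - 1)))
    (hVm : AEStronglyMeasurable V) (hV : WeakBound m v volume (fun y => ‖V y‖ₑ))
    {p : ℝ} (hp : 1 < p) (hu₀ : MemWeak p (volHalf n) u₀)
    (hum : AEStronglyMeasurable (fun z : ℝ × Bdry n => trace (u z.1) z.2)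
      ((volume.restrict (Ioi 0)).prod volume))
    (hu : ∀ s, 0 < s → WeakBound q N volume (fun y => ‖trace (u s) y‖ₑ))
    (hint : ∀ t, 0 < t → ∀ᵐ x ∂(volHalf n), u t x = mildMap h V u₀ u t x)
    (hbdry : ∀ t, 0 < t → ∀ᵐ y' : Bdry n, u t (y', 0) = mildMap h V u₀ u t (y', 0))
    (hneg : ∀ a, a ≤ 0 → h a ≤ 0) (hVpos : ∀ᵐ y, 0 ≤ V y)
    (hu₀neg : ∀ᵐ x ∂(volHalf n), u₀ x ≤ 0)
    (hU : ∃ U : Set (Space n), U ⊆ halfSpace n ∧ 0 < volume U ∧ ∀ x ∈ U, u₀ x < 0) :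
    (∀ t, 0 < t → ∀ᵐ x ∂(volHalf n), u t x < 0) ∧
      (∀ t, 0 < t → ∀ x ∈ halfSpace n, mildMap h V u₀ u t x < 0) := by
  obtain ⟨U, hU, hUpos, hUu⟩ := hU
  have key := hS.pos (h := fun a => -h (-a)) (V := V) (u₀ := fun y => -u₀ y)
    (u := fun s y => -u s y) (by simp [h0])
    (fun a b => by
      have := hh (-a) (-b)
      rw [abs_neg a, abs_neg b, show -a - -b = -(a - b) by ring, abs_neg (a - b)] at this
      rwa [show -h (-a) - -h (-b) = -(h (-a) - h (-b)) by ring, abs_neg])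
    hVm hV hp ⟨hu₀.1.neg, by rw [weakNorm_neg]; exact hu₀.2⟩ hum.neg
    (fun s hs => by simpa only [trace, enorm_neg] using hu s hs)
    (fun t ht => by
      filter_upwards [hint t ht] with x hx
      rw [mildMap_neg, ← hx])
    (fun t ht => by
      filter_upwards [hbdry t ht] with x hx
      rw [mildMap_neg, ← hx])
    (fun a ha => neg_nonneg.2 (hneg _ (neg_nonpos.2 ha))) hVpos
    (by filter_upwards [hu₀neg] with x hx using neg_nonneg.2 hx)
    ⟨U, hU, hUpos, fun x hx => neg_pos.2 (hUu x hx)⟩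
  refine ⟨fun t ht => ?_, fun t ht x hx => ?_⟩
  · filter_upwards [key.1 t ht] with x hx
    exact neg_pos.1 hx
  · have := key.2 t ht x hx
    rw [mildMap_neg] at this
    exact neg_pos.1 this

/-! ### Rotational symmetry and antisymmetry. -/

section rotation

theorem heatKernel_axisRotation (R : Bdry n ≃ₗᵢ[ℝ] Bdry n) (x y : Space n) (t : ℝ) :
    heatKernel (axisRotation R x) (axisRotation R y) t = heatKernel x y t := by
  simp only [heatKernel, axisRotation, ← map_sub, LinearIsometryEquiv.norm_map]

theorem measurableEmbedding_axisRotation (R : Bdry n ≃ₗᵢ[ℝ] Bdry n) :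
    MeasurableEmbedding (axisRotation R : Space n → Space n) :=
  (R.toHomeomorph.toMeasurableEquiv.prodCongr (MeasurableEquiv.refl ℝ)).measurableEmbedding

theorem measurePreserving_axisRotation (R : Bdry n ≃ₗᵢ[ℝ] Bdry n) :
    MeasurePreserving (axisRotation R : Space n → Space n) (volHalf n) (volHalf n) := by
  have h1 : MeasurePreserving (axisRotation R : Space n → Space n) volume volume :=
    R.measurePreserving.prod (MeasurePreserving.id volume)
  exact h1.restrict_preimage (s := halfSpace n) (measurableSet_lt measurable_const measurable_snd)

/-- The mild map commutes with rotations and, for odd nonlinearities, with reflections. -/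
theorem mildMap_axisRotation {R : Bdry n ≃ₗᵢ[ℝ] Bdry n} {e : ℝ}
    (hodd : ∀ a, h (e * a) = e * h a) (hV : ∀ᵐ y : Bdry n, V y = V (R y))
    (hu₀ : ∀ᵐ x ∂(volHalf n), u₀ x = e * u₀ (axisRotation R x)) (t : ℝ) (x : Space n) :
    mildMap h V u₀ (fun s y => e * u s (axisRotation R y)) t x =
      e * mildMap h V u₀ u t (axisRotation R x) := by
  unfold mildMap
  rw [mul_add, ← integral_const_mul, ← intervalIntegral.integral_const_mul]
  congr 1
  · rw [← (measurePreserving_axisRotation R).integral_comp (measurableEmbedding_axisRotation R)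
      fun y => e * (heatKernel (axisRotation R x) y t * u₀ y)]
    refine integral_congr_ae ?_
    filter_upwards [hu₀] with y hy
    rw [hy, heatKernel_axisRotation]
    ring
  · refine intervalIntegral.integral_congr fun s _ => ?_
    dsimp only
    rw [← integral_const_mul, ← R.measurePreserving.integral_comp
      R.toHomeomorph.toMeasurableEquiv.measurableEmbedding
      fun y => e * (heatKernel (axisRotation R x) (y, 0) (t - s) *
        (h (trace (u s) y) + V y * trace (u s) y))]
    refine integral_congr_ae ?_
    filter_upwards [hV] with y hy
    have e1 : heatKernel (axisRotation R x) (R y, 0) (t - s) = heatKernel x (y, 0) (t - s) :=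
      heatKernel_axisRotation R x (y, 0) (t - s)
    have e2 : trace (fun z => e * u s (axisRotation R z)) y = e * trace (u s) (R y) := rfl
    rw [e1, e2, hodd, ← hy]
    ring

/-- Almost-everywhere equality of traces gives equality at every point x, which carries symmetry
from the boundary into the interior. -/
theorem mildMap_congr_trace {u' : ℝ → Space n → ℝ}
    (huu : ∀ s, 0 < s → ∀ᵐ y, trace (u s) y = trace (u' s) y) {t : ℝ} (ht : 0 < t) (x : Space n) :
    mildMap h V u₀ u t x = mildMap h V u₀ u' t x := by
  unfold mildMap
  congr 1
  rw [intervalIntegral.integral_of_le ht.le, intervalIntegral.integral_of_le ht.le]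
  refine setIntegral_congr_fun measurableSet_Ioc fun s hs => integral_congr_ae ?_
  filter_upwards [huu s hs.1] with y hy
  rw [hy]

/-- Mild solutions inherit the symmetries of the data. -/
theorem SmallnessRegime.equivariant (hS : SmallnessRegime n η ρ m q r C κ v N) (h0 : h 0 = 0)
    (hh : ∀ a b : ℝ, |h a - h b| ≤ η * |a - b| * (|a| ^ (ρ - 1) + |b| ^ (ρ - 1)))
    (hVm : AEStronglyMeasurable V) (hV : WeakBound m v volume (fun y => ‖V y‖ₑ))
    (hum : AEStronglyMeasurable (fun z : ℝ × Bdry n => trace (u z.1) z.2)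
      ((volume.restrict (Ioi 0)).prod volume))
    (hu : ∀ s, 0 < s → WeakBound q N volume (fun y => ‖trace (u s) y‖ₑ))
    (hint : ∀ t, 0 < t → ∀ᵐ x ∂(volHalf n), u t x = mildMap h V u₀ u t x)
    (hbdry : ∀ t, 0 < t → ∀ᵐ y' : Bdry n, u t (y', 0) = mildMap h V u₀ u t (y', 0))
    {R : Bdry n ≃ₗᵢ[ℝ] Bdry n} {e : ℝ} (he : |e| = 1)
    (hodd : ∀ a, h (e * a) = e * h a) (hVR : ∀ᵐ y : Bdry n, V y = V (R y))
    (hu₀ : ∀ᵐ x ∂(volHalf n), u₀ x = e * u₀ (axisRotation R x)) {t : ℝ} (ht : 0 < t) :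
    (∀ᵐ x ∂(volHalf n), u t x = e * u t (axisRotation R x)) ∧
      ∀ᵐ y : Bdry n, trace (u t) y = e * trace (u t) (R y) := by
  -- The factor e is 1 for symmetry and -1 for antisymmetry. The curve u' has the same bounds and
  -- solves the same boundary equation, with the same initial term, so uniqueness applies.
  set u' : ℝ → Space n → ℝ := fun s y => e * u s (axisRotation R y) with hu'
  have hmild : ∀ t x, mildMap h V u₀ u' t x = e * mildMap h V u₀ u t (axisRotation R x) :=
    fun t x => mildMap_axisRotation hodd hVR hu₀ t x
  have hRm := R.measurePreserving
  have hRe : MeasurableEmbedding R := R.toHomeomorph.toMeasurableEquiv.measurableEmbedding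
  have htr : ∀ t, 0 < t → ∀ᵐ y, trace (u t) y = trace (u' t) y := by
    refine hS.bdry_unique (w₁ := fun t y => trace (u t) y) (w₂ := fun t y => trace (u' t) y)
      (F := fun t x => ∫ y, heatKernel (x, 0) y t * u₀ y ∂(volHalf n)) h0 hh hVm hV hum ?_ hu ?_
      hbdry ?_
    · exact (hum.comp_quasiMeasurePreserving
        ((MeasurePreserving.id _).prod hRm).quasiMeasurePreserving).const_mul e
    · intro s hs σ hσ
      have hset : {y | ENNReal.ofReal σ < ‖trace (u' s) y‖ₑ} =
          R ⁻¹' {y | ENNReal.ofReal σ < ‖trace (u s) y‖ₑ} := by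
        ext y
        have : ‖e‖ₑ = 1 := by rw [Real.enorm_eq_ofReal_abs, he, ENNReal.ofReal_one]
        simp [hu', trace, axisRotation, enorm_mul, this]
      rw [hset, hRm.measure_preimage_emb hRe]
      exact hu s hs σ hσ
    · intro s hs
      filter_upwards [hRm.quasiMeasurePreserving.ae (hbdry s hs)] with y hy
      have : e * u s (R y, 0) = mildMap h V u₀ u' s (y, 0) := by
        rw [hy, hmild]; rfl
      exact this
  refine ⟨?_, htr t ht⟩
  filter_upwards [hint t ht,
    (measurePreserving_axisRotation R).quasiMeasurePreserving.ae (hint t ht)] with x h1 h2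
  rw [h1, h2, mildMap_congr_trace htr ht, hmild]

end rotation

/-! ### Choice of δ₁ and ε. -/

/-- A choice of smallness constants. -/
theorem exists_smallnessRegime (hn : 3 ≤ n) (hρ : 1 < ρ) (hρn : ρ / (ρ - 1) < (n : ℝ) - 1)
    (hq : q = ((n : ℝ) - 1) * (ρ - 1)) :
    ∃ δ₁ : ℝ, 0 < δ₁ ∧ ∀ η γ₀ : ℝ, γ₀ < 1 → ∃ ε : ℝ, 0 < ε ∧ ∀ v : ℝ, 0 ≤ v → δ₁ * v ≤ γ₀ →
      ∃ r C κ N : ℝ, 2 * ε / (1 - δ₁ * v) ≤ N ∧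
        SmallnessRegime n η ρ ((n : ℝ) - 1) q r C κ v N := by
  have hn' : (3 : ℝ) ≤ n := by exact_mod_cast hn
  have hρ' : 0 < ρ - 1 := by linarith
  have hqρ : ρ < q := by
    rw [div_lt_iff₀ hρ'] at hρn
    rwa [hq]
  have hq0 : 0 < q := by linarith
  have hr : 1 < q / ρ := by rwa [one_lt_div (by linarith)]
  have hinv : 1 / (q / ρ) = 1 / ((n : ℝ) - 1) + 1 / q := by
    have h1 : (0 : ℝ) < (n : ℝ) - 1 := by linarith
    rw [hq]
    field_simp
    ring
  obtain ⟨C, hC, hCb⟩ := (isHeatLike_bdryKernel (n := n) (by omega)).exists_heatPotentialBound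
    (by linarith) two_pos hq0 hr hinv
  -- With κ = (1+γ₀)/(4C) below, the contraction factor 2Cκ is (1+γ₀)/2 < 1. The coefficient
  -- condition reads 8Cv + 32C·max(η,0)·N^(ρ-1) ≤ 1+γ₀. As 4Cv ≤ γ₀, the first term is at most 2γ₀,
  -- which leaves 1-γ₀ for the second; Y bounds N^(ρ-1) accordingly.
  refine ⟨4 * C, by positivity, fun η γ₀ hγ₀ => ?_⟩
  have hη := le_max_right η 0
  have hg : 0 < 1 - γ₀ := by linarith
  set Y : ℝ := (1 - γ₀) / (2 * (16 * C * max η 0 + 1)) with hY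
  have hYpos : 0 < Y := by positivity
  set X : ℝ := Y ^ (1 / (ρ - 1)) with hX
  have hXpos : 0 < X := by positivity
  have hXY : X ^ (ρ - 1) = Y := by
    rw [hX, ← Real.rpow_mul hYpos.le, one_div_mul_cancel hρ'.ne', Real.rpow_one]
  have hsmall : 16 * C * max η 0 * Y ≤ (1 - γ₀) / 2 := by
    have : (16 * C * max η 0 + 1) * Y = (1 - γ₀) / 2 := by rw [hY]; field_simp
    nlinarith
  -- This ε gives 2ε/(1-γ) = X(1-γ₀)/(1-γ) ≤ X whenever γ ≤ γ₀.
  refine ⟨(1 - γ₀) / 2 * X, by positivity, fun v hv hvγ => ?_⟩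
  -- A negative γ₀ admits no V, so κ is positive in the only case that matters.
  have hγ₀0 : 0 ≤ γ₀ := le_trans (by positivity) hvγ
  refine ⟨q / ρ, C, (1 + γ₀) / (4 * C), X, ?_, ⟨hCb, hρ, by linarith, hq, by linarith, hr, hinv, hC,
    by positivity, ?_, hv, hXpos, ?_⟩⟩
  · rw [div_le_iff₀ (by linarith)]
    nlinarith
  · rw [show 2 * C * ((1 + γ₀) / (4 * C)) = (1 + γ₀) / 2 by field_simp; ring]
    linarith
  · rw [hXY, le_div_iff₀ (by positivity)]
    nlinarith

end HalfSpaceHeat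

/-! ### The theorem. -/

theorem mainTheorem3 (n : ℕ) (hn : 3 ≤ n) (ρ : ℝ) (hρ : 1 < ρ) (hρn : ρ / (ρ - 1) < (n : ℝ) - 1)
    (p q : ℝ) (hp : p = (n : ℝ) * (ρ - 1)) (hq : q = ((n : ℝ) - 1) * (ρ - 1)) :
    ∃ δ₁ : ℝ, 0 < δ₁ ∧ ∀ η γ₀ : ℝ, γ₀ < 1 → ∃ ε : ℝ, 0 < ε ∧
      ∀ (h : ℝ → ℝ) (V : HalfSpaceHeat.Bdry n → ℝ) (u₀ : HalfSpaceHeat.Space n → ℝ)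
        (u : ℝ → HalfSpaceHeat.Space n → ℝ) (γ : ℝ),
        h 0 = 0 →
        (∀ a b : ℝ, |h a - h b| ≤ η * |a - b| * (|a| ^ (ρ - 1) + |b| ^ (ρ - 1))) →
        HalfSpaceHeat.MemWeak ((n : ℝ) - 1) volume V →
        γ = δ₁ * (HalfSpaceHeat.weakNorm ((n : ℝ) - 1) volume V).toReal →
        γ ≤ γ₀ →
        HalfSpaceHeat.MemWeak p (HalfSpaceHeat.volHalf n) u₀ →
        HalfSpaceHeat.IsMildSolution p q h V u₀ u →
        (∀ t, 0 < t → HalfSpaceHeat.normX p q (u t) ≤ ENNReal.ofReal (2 * ε / (1 - γ))) →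
        -- positivity
        ((∀ a, 0 ≤ a → 0 ≤ h a) →
          (∀ᵐ y' : HalfSpaceHeat.Bdry n, 0 ≤ V y') →
          (∀ᵐ x ∂(HalfSpaceHeat.volHalf n), 0 ≤ u₀ x) →
          (∃ U : Set (HalfSpaceHeat.Space n), U ⊆ HalfSpaceHeat.halfSpace n ∧ 0 < volume U ∧
            ∀ x ∈ U, 0 < u₀ x) →
          (∀ t, 0 < t → ∀ᵐ x ∂(HalfSpaceHeat.volHalf n), 0 < u t x) ∧
          (∀ t, 0 < t → ∀ x ∈ HalfSpaceHeat.halfSpace n,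
            0 < HalfSpaceHeat.mildMap h V u₀ u t x)) ∧
        -- negativity
        ((∀ a, a ≤ 0 → h a ≤ 0) →
          (∀ᵐ y' : HalfSpaceHeat.Bdry n, 0 ≤ V y') →
          (∀ᵐ x ∂(HalfSpaceHeat.volHalf n), u₀ x ≤ 0) →
          (∃ U : Set (HalfSpaceHeat.Space n), U ⊆ HalfSpaceHeat.halfSpace n ∧ 0 < volume U ∧
            ∀ x ∈ U, u₀ x < 0) →
          (∀ t, 0 < t → ∀ᵐ x ∂(HalfSpaceHeat.volHalf n), u t x < 0) ∧
          (∀ t, 0 < t → ∀ x ∈ HalfSpaceHeat.halfSpace n,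
            HalfSpaceHeat.mildMap h V u₀ u t x < 0)) ∧
        -- symmetry and antisymmetry
        ((∀ a, h a = -h (-a)) →
          ∀ 𝒜 : Set (HalfSpaceHeat.Bdry n ≃ₗᵢ[ℝ] HalfSpaceHeat.Bdry n),
            HalfSpaceHeat.IsSymmBdry 𝒜 V →
            (HalfSpaceHeat.IsSymm 𝒜 u₀ → ∀ t, 0 < t →
              HalfSpaceHeat.IsSymm 𝒜 (u t) ∧
                HalfSpaceHeat.IsSymmBdry 𝒜 (HalfSpaceHeat.trace (u t))) ∧
            (HalfSpaceHeat.IsAntisymm 𝒜 u₀ → ∀ t, 0 < t →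
              HalfSpaceHeat.IsAntisymm 𝒜 (u t) ∧
                HalfSpaceHeat.IsAntisymmBdry 𝒜 (HalfSpaceHeat.trace (u t)))) := by
  obtain ⟨δ₁, hδ₁, hmain⟩ := HalfSpaceHeat.exists_smallnessRegime hn hρ hρn hq
  refine ⟨δ₁, hδ₁, fun η γ₀ hγ₀ => ?_⟩
  obtain ⟨ε, hε, hreg⟩ := hmain η γ₀ hγ₀
  refine ⟨ε, hε, fun h V u₀ u γ h0 hh hV hγ hγle hu₀ hu hsmall => ?_⟩
  have hn' : (3 : ℝ) ≤ n := by exact_mod_cast hn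
  obtain ⟨r, C, κ, N, hN, hS⟩ := hreg _ ENNReal.toReal_nonneg (hγ ▸ hγle)
  rw [← hγ] at hN
  have hq1 : 1 ≤ q := hS.one_le_q
  have hp1 : 1 < p := by
    have : p = q + (ρ - 1) := by rw [hp, hq]; ring
    linarith
  have hVw : HalfSpaceHeat.WeakBound ((n : ℝ) - 1) _ volume (fun y => ‖V y‖ₑ) :=
    HalfSpaceHeat.weakBound_of_weakNorm_le (by linarith) ENNReal.toReal_nonneg
      (ENNReal.ofReal_toReal hV.2.ne).ge
  have huw : ∀ s, 0 < s →
      HalfSpaceHeat.WeakBound q N volume (fun y => ‖HalfSpaceHeat.trace (u s) y‖ₑ) := fun s hs =>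
    HalfSpaceHeat.weakBound_of_weakNorm_le (by linarith) hS.N_pos.le
      (le_add_self.trans ((hsmall s hs).trans (ENNReal.ofReal_le_ofReal hN)))
  have hum := hu.memBC.measurable_trace
  refine ⟨fun hpos hVpos hu₀pos hU => hS.pos h0 hh hV.1 hVw hp1 hu₀ hum huw hu.eq_interior
      hu.eq_boundary hpos hVpos hu₀pos hU,
    fun hneg hVpos hu₀neg hU => hS.neg h0 hh hV.1 hVw hp1 hu₀ hum huw hu.eq_interior
      hu.eq_boundary hneg hVpos hu₀neg hU,
    fun hodd 𝒜 hVA => ⟨fun hu₀A t ht => ?_, fun hu₀A t ht => ?_⟩⟩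
  · have key := fun R hR => hS.equivariant (R := R) (e := 1) h0 hh hV.1 hVw hum huw hu.eq_interior
      hu.eq_boundary (by simp) (by simp) (hVA R hR) (by simpa using hu₀A R hR) ht
    exact ⟨fun R hR => by simpa using (key R hR).1, fun R hR => by simpa using (key R hR).2⟩
  · have key := fun R hR => hS.equivariant (R := R) (e := -1) h0 hh hV.1 hVw hum huw hu.eq_interior
      hu.eq_boundary (by simp) (fun a => by rw [hodd a]; simp) (hVA R hR)
      (by simpa using hu₀A R hR) ht
    exact ⟨fun R hR => by simpa using (key R hR).1, fun R hR => by simpa using (key R hR).2⟩
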